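/- **Setting.** For a finite simple graph $G=(V,E)$ a *dimeric configuration* is a set $D\subseteq E$ of edges no two of which share a vertex, and $\mathscr M_G(D)$ is the set of vertices not covered by $D$, so that $|\mathscr M_G(D)|=|V|-2|D|$. For $x>0$ let $Z_G(x)=\sum_D x^{|V|-2|D|}$, let $\mu_{G,x}(D)=x^{|V|-2|D|}/Z_G(x)$, and let $\mathcal R_x(G,v)=\mu_{G,x}(v\in\mathscr M_G(D))$ be the probability that the vertex $v$ is uncovered. The *monomer density* is $\varepsilon_G(x)=x\,\frac{\partial}{\partial x}\frac{\log Z_G(x)}{|V|}$. Let $P=(P_k)_{k\ge0}$ and $\rho=(\rho_k)_{k\ge0}$ be probability distributions on $\mathbb N$ with $\overline P=\sum_k kP_k<\infty$ and $\rho_k=(k+1)P_{k+1}/\overline P$ for all $k$. The *unimodular Galton–Watson tree* $\mathcal T(P,\rho)$ is the random rooted tree in which the numbers of children of the individuals are independent, with distribution $P$ for the root and $\rho$ for every other individual; $\mathcal T(P,\rho,r)$ is its subtree induced by the generations $0,\dots,r$. For a graph $G$, $[G,v]_r$ denotes the subgraph induced by the vertices at distance at most $r$ from $v$, and $\cong$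 denotes isomorphism of rooted graphs. A sequence of finite random graphs $G_n=(V_n,E_n)$ on a common probability space *converges locally* to $\mathcal T(P,\rho)$ if for every $r\in\mathbb N$ and every finite rooted tree $(T,o)$ with at most $r$ generations $$\frac1{|V_n|}\sum_{v\in V_n}\mathbf 1\big(([G_n,v]_r,v)\cong(T,o)\big)\ \xrightarrow[n\to\infty]{\text{a.s.}}\ \mathbb P\big((\mathcal T(P,\rho,r),o)\cong(T,o)\big).$$ **Theorem.** Let $(G_n)_{n\in\mathbb N}$ be a sequence of finite random simple graphs that converges locally to the unimodular Galton–Watson tree $\mathcal T(P,\rho)$, where $P$ has finite second moment. For every $x>0$ there is exactly one probability distribution supported in $[0,1]$ that solves the distributional equation $$X\overset{\mathcal D}{=}\frac{x^2}{x^2+\sum_{i=1}^K X_i},$$ where $(X_i)_{i\ge1}$ are i.i.d. copies of $X$ and $K$ has distribution $\rho$ and is independent of $(X_i)_{i\ge1}$. With $(X_i)_{i\ge1}$ i.i.d. with this distribution and $\Delta$ with distribution $P$, independent of $(X_i)_{i\ge1}$, let $Y(x)$ have the distribution of $\dfrac{x^2}{x^2+\sum_{i=1}^{\Delta}X_i}$.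 Then almost surely, for all $x>0$, $$\varepsilon_{G_n}(x)=x\,\frac{\partial}{\partial x}\frac{\log Z_{G_n}(x)}{|V_n|}=\frac1{|V_n|}\sum_{v\in V_n}\mathcal R_x(G_n,v)\ \xrightarrow[n\to\infty]{}\ \mathbb E[Y(x)],$$ and the function $x\mapsto\mathbb E[Y(x)]$ is analytic on $\mathbb R_+=(0,\infty)$. -/

import Mathlib

open MeasureTheory Filter Topology Set
open scoped ENNReal

namespace MonomerDimer

noncomputable section

/-! ### The monomer-dimer model on a finite simple graph -/

section Model

open scoped Classical in
/-- The dimeric configurations of `G`: sets of edges, no two of which have a vertex in common. -/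
def dimericConfigs {V : Type*} [Fintype V] (G : SimpleGraph V) : Finset (Finset (Sym2 V)) :=
  Finset.univ.filter fun D =>
    (∀ e ∈ D, e ∈ G.edgeSet) ∧ ∀ e ∈ D, ∀ f ∈ D, ∀ v : V, v ∈ e → v ∈ f → e = f

open scoped Classical in
/-- The monomeric configuration of `D`: the vertices not covered by `D`. -/
def monomers {V : Type*} [Fintype V] (D : Finset (Sym2 V)) : Finset V :=
  Finset.univ.filter fun v => ∀ u : V, s(u, v) ∉ D

/-- In a dimeric configuration `|M(D)| + 2 |D| = |V|`, so that the subtraction `|V| - 2 |D|`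
in `gibbsFactor` below never truncates. -/
theorem card_monomers_add {V : Type*} [Fintype V] (G : SimpleGraph V) (D : Finset (Sym2 V))
    (hD : D ∈ dimericConfigs G) : (monomers D).card + 2 * D.card = Fintype.card V := by
  classical
  simp only [dimericConfigs, Finset.mem_filter, Finset.mem_univ, true_and] at hD
  obtain ⟨hE, hdisj⟩ := hD
  have h1 : (D.biUnion fun e => Finset.univ.filter fun v : V => v ∈ e).card = 2 * D.card := by
    rw [Finset.card_biUnion, Finset.sum_const_nat (m := 2), mul_comm]
    · intro e he
      have hd : ¬ e.IsDiag := G.not_isDiag_of_mem_edgeSet (hE e he)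
      have : (Finset.univ.filter fun v : V => v ∈ e) = e.toFinset := by
        ext v; simp
      rw [this, Sym2.card_toFinset_of_not_isDiag e hd]
    · intro e he f hf hne
      rw [Function.onFun, Finset.disjoint_left]
      intro v hv hv'
      simp only [Finset.mem_filter, Finset.mem_univ, true_and] at hv hv'
      exact hne (hdisj e he f hf v hv hv')
  have h2 : monomers D
      = Finset.univ \ (D.biUnion fun e => Finset.univ.filter fun v : V => v ∈ e) := by
    ext v
    simp only [monomers, Finset.mem_filter, Finset.mem_univ, true_and, Finset.mem_sdiff,
      Finset.mem_biUnion, not_exists, not_and]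
    constructor
    · intro h e he hve
      obtain ⟨u, rfl⟩ := Sym2.mem_iff_exists.1 hve
      exact h u (by rwa [Sym2.eq_swap])
    · intro h u hu
      exact h _ hu (Sym2.mem_mk_right u v)
  rw [h2, ← h1]
  exact Finset.card_sdiff_add_card_eq_card (Finset.subset_univ _)

/-- The unnormalised weight `x ^ (|V| - 2 |D|)` of a dimeric configuration. -/
def gibbsFactor {V : Type*} [Fintype V] (x : ℝ) (D : Finset (Sym2 V)) : ℝ :=
  x ^ (Fintype.card V - 2 * D.card)

/-- The partition function `Z_G(x)`. -/
def partitionFunction {V : Type*} [Fintype V] (G : SimpleGraph V) (x : ℝ) : ℝ :=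
  ∑ D ∈ dimericConfigs G, gibbsFactor x D

/-- The expectation `⟨f⟩_{G,x}` for the probability measure `D ↦ x ^ (|V| - 2 |D|) / Z_G(x)`. -/
def gibbsExpectation {V : Type*} [Fintype V] (G : SimpleGraph V) (x : ℝ)
    (f : Finset (Sym2 V) → ℝ) : ℝ :=
  ∑ D ∈ dimericConfigs G, f D * (gibbsFactor x D / partitionFunction G x)

open scoped Classical in
/-- `R_x(G,v)`: the probability of having a monomer at the vertex `v`. -/
def monomerProb {V : Type*} [Fintype V] (G : SimpleGraph V) (x : ℝ) (v : V) : ℝ :=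
  gibbsExpectation G x fun D => if v ∈ monomers D then 1 else 0

/-- The pressure per particle `(log Z_G(x)) / |V|`. -/
def pressurePerParticle {V : Type*} [Fintype V] (G : SimpleGraph V) (x : ℝ) : ℝ :=
  Real.log (partitionFunction G x) / Fintype.card V

/-- The monomer density `ε_G(x) = x ∂/∂x ((log Z_G(x)) / |V|)`. -/
def monomerDensity {V : Type*} [Fintype V] (G : SimpleGraph V) (x : ℝ) : ℝ :=
  x * deriv (pressurePerParticle G) x

end Model

/-! ### Rooted graphs and balls -/

/-- `(G,v) ≅ (H,w)` as rooted graphs. -/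
def RootedIso {V W : Type*} (G : SimpleGraph V) (v : V) (H : SimpleGraph W) (w : W) : Prop :=
  ∃ φ : G ≃g H, φ v = w

/-- The vertices at graph distance at most `r` from `v`. -/
def closedBall {V : Type*} (G : SimpleGraph V) (v : V) (r : ℕ) : Set V :=
  {w | G.edist v w ≤ r}

theorem self_mem_closedBall {V : Type*} (G : SimpleGraph V) (v : V) (r : ℕ) :
    v ∈ closedBall G v r := by
  simp [closedBall]

/-- The rooted graphs `([G,v]_r, v)` and `(T,o)` are isomorphic, where `[G,v]_r` is the subgraph of
`G` induced by the ball of centre `v` and radius `r`. -/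
def BallIso {V W : Type*} (G : SimpleGraph V) (v : V) (r : ℕ) (T : SimpleGraph W) (o : W) : Prop :=
  RootedIso (G.induce (closedBall G v r)) ⟨v, self_mem_closedBall G v r⟩ T o

/-! ### Galton-Watson trees

Individuals are labelled by finite words over `ℕ`: the empty word is the root, `u ++ [i]` is the
`i`-th child of `u` (counting from `0`), and the generation of an individual is the length of its
word. `k u` is the number of children of `u`. -/

/-- The individuals that are born when the offspring numbers are `k`. -/
def gwNodes (k : List ℕ → ℕ) : Set (List ℕ) :=
  {u | ∀ (w : List ℕ) (i : ℕ), w ++ [i] <+: u → i < k w}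

/-- The individuals in the generations `0, …, r`. -/
def gwNodesUpTo (k : List ℕ → ℕ) (r : ℕ) : Set (List ℕ) :=
  {u | u ∈ gwNodes k ∧ u.length ≤ r}

theorem nil_mem_gwNodesUpTo (k : List ℕ → ℕ) (r : ℕ) : [] ∈ gwNodesUpTo k r := by
  simp [gwNodesUpTo, gwNodes]

/-- Two words are adjacent if one is the parent of the other. -/
def wordGraph : SimpleGraph (List ℕ) where
  Adj u v := (∃ i, v = u ++ [i]) ∨ (∃ i, u = v ++ [i])
  symm := ⟨fun _ _ h => h.symm⟩
  loopless := ⟨fun u h => by rcases h with ⟨i, h⟩ | ⟨i, h⟩ <;> simp at h⟩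

/-- The tree with offspring numbers `k`, truncated after the generation `r`. -/
def gwTree (k : List ℕ → ℕ) (r : ℕ) : SimpleGraph (gwNodesUpTo k r) :=
  wordGraph.induce (gwNodesUpTo k r)

/-- The root of the truncated tree. -/
def gwRoot (k : List ℕ → ℕ) (r : ℕ) : gwNodesUpTo k r :=
  ⟨[], nil_mem_gwNodesUpTo k r⟩

/-- The joint law of the offspring numbers in `T(P,ρ)`: they are independent, with distribution `P`
at the root and `ρ` at every other individual. -/
def gwMeasure (P ρ : PMF ℕ) : Measure (List ℕ → ℕ) :=
  Measure.infinitePi fun u => (if u = [] then P else ρ).toMeasure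

/-- The probability that the Galton-Watson tree `T(P,ρ)`, truncated after the generation `r`, is
isomorphic to `(T,o)` as a rooted graph. -/
def gwProb (P ρ : PMF ℕ) (r : ℕ) {W : Type*} (T : SimpleGraph W) (o : W) : ℝ :=
  (gwMeasure P ρ).real {k | RootedIso (gwTree k r) (gwRoot k r) T o}

/-- `ρ_k = (k+1) P_{k+1} / ∑_j j P_j` with a finite mean of `P`. (The mean is then also positive,
as `ρ` is a probability distribution.) -/
def IsUnimodular (P ρ : PMF ℕ) : Prop :=
  ∑' j : ℕ, (j : ℝ≥0∞) * P j ≠ ∞ ∧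
    ∀ k : ℕ, ρ k = ((k + 1 : ℕ) : ℝ≥0∞) * P (k + 1) / ∑' j : ℕ, (j : ℝ≥0∞) * P j

/-! ### Local convergence -/

open scoped Classical in
/-- The proportion of vertices `v` of `G` with `([G,v]_r, v) ≅ (T,o)`. -/
def ballFrequency {V W : Type*} [Fintype V] (G : SimpleGraph V) (r : ℕ)
    (T : SimpleGraph W) (o : W) : ℝ :=
  (∑ v : V, if BallIso G v r T o then (1 : ℝ) else 0) / Fintype.card V

/-- The random graphs `G_n` converge locally to the Galton-Watson tree `T(P,ρ)`: for every `r` and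
every finite rooted tree `(T,o)` with at most `r` generations, almost surely the proportion of
vertices of `G_n` whose ball of radius `r` is isomorphic to `(T,o)` tends to the probability that
`T(P,ρ)` truncated after the generation `r` is isomorphic to `(T,o)`. -/
def LocallyConverges {Ω : Type*} [MeasurableSpace Ω] (ℙ : Measure Ω)
    {V : ℕ → Ω → Type*} [∀ n ω, Fintype (V n ω)] (G : ∀ n ω, SimpleGraph (V n ω))
    (P ρ : PMF ℕ) : Prop :=
  ∀ (r m : ℕ) (T : SimpleGraph (Fin m)) (o : Fin m),
    T.IsTree → (∀ v, T.edist o v ≤ r) →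
      ∀ᵐ ω ∂ℙ, Tendsto (fun n => ballFrequency (G n ω) r T o) atTop (𝓝 (gwProb P ρ r T o))

/-! ### The distributional equation -/

/-- The law of `x² / (x² + ∑_{i=1}^N X_i)`, where `N` has distribution `D`, the `X_i` are i.i.d.
with law `μ`, and `N` is independent of the `X_i`. -/
def recursionLaw (D : PMF ℕ) (x : ℝ) (μ : ProbabilityMeasure ℝ) : Measure ℝ :=
  (D.toMeasure.prod (Measure.infinitePi fun _ : ℕ => (μ : Measure ℝ))).map
    fun p : ℕ × (ℕ → ℝ) => x ^ 2 / (x ^ 2 + ∑ i ∈ Finset.range p.1, p.2 i)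

theorem measurable_recursion (x : ℝ) :
    Measurable fun p : ℕ × (ℕ → ℝ) => x ^ 2 / (x ^ 2 + ∑ i ∈ Finset.range p.1, p.2 i) := by
  refine measurable_from_prod_countable_right fun n => ?_
  dsimp only
  fun_prop

/-- `μ` is supported in `[0,1]` and solves the distributional equation
`X = x² / (x² + ∑_{i=1}^K X_i)`, where `K` has distribution `ρ`. -/
def IsFixedLaw (ρ : PMF ℕ) (x : ℝ) (μ : ProbabilityMeasure ℝ) : Prop :=
  (μ : Measure ℝ) (Icc (0 : ℝ) 1)ᶜ = 0 ∧ recursionLaw ρ x μ = (μ : Measure ℝ)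

end

end MonomerDimer

open MonomerDimer

/-! Splitting configurations according to the edge that covers `v` gives R(G,v) = x²/(x² + ∑_{w∼v}
R(G−v,w)) (`monomerProb_recursion`). The right side is decreasing in the unknowns, so iterating it
from the value 1 gives upper bounds at even depths and lower bounds at odd depths
(`cavity_bounds_monomerProb`), and the iterate of depth r sees only the ball of radius r
(`cavity_embedding`). Local convergence then turns averages of a fixed iterate over the graph into
its expectation on the tree (`tendsto_average_cavity`). It remains to close the gap on the tree
between the decreasing limit U of the even iterates and the increasing limit L of the odd ones.

Here L ≤ U, and each is the recursion applied to the other. By unimodularity the mean of 1 − L or of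
1 − U at the root is the mean of P times E[ab/(x²+ab)], where a and b are independent and are the
messages travelling in the two directions along a typical edge (`lintegral_one_sub_recursionLaw`).
Exchanging U and L merely exchanges a and b, and the integrand is symmetric. Hence L and U have
equal means at the root and agree almost surely (`gwLower_eq_gwUpper_of_root`); looking at a child
of the root gives the same for the tree with offspring law ρ throughout.

The recursion also reverses stochastic order, so every fixed law in [0,1] is squeezed between the
laws of the even and odd iterates; since these have the same limit, the fixed law is unique
(`IsFixedLaw.eq_gwLaw`).

For analyticity, the recursion is run with complex z, Re z > 0. The quotients h = R/z satisfy h =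
1/(z + ∑ h_w), so Re h ≥ 0 and |h| ≤ 1/Re z independently of the graph (`cavity_div_bounds`). A
pointwise limit of locally bounded holomorphic functions on an interval is analytic there, by
passing to the limit in Taylor coefficients (`analyticAt_of_tendsto_re`). -/

namespace MonomerDimer

/-! ### Recursions for the partition function and the monomer probabilities -/

section Recursion

variable {V : Type*} [Fintype V]

theorem mem_dimericConfigs {G : SimpleGraph V} {D : Finset (Sym2 V)} :
    D ∈ dimericConfigs G ↔ (∀ e ∈ D, e ∈ G.edgeSet) ∧
      ∀ e ∈ D, ∀ f ∈ D, ∀ v : V, v ∈ e → v ∈ f → e = f := by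
  simp [dimericConfigs]

theorem mem_monomers {D : Finset (Sym2 V)} {v : V} : v ∈ monomers D ↔ ∀ u : V, s(u, v) ∉ D := by
  simp [monomers]

theorem gibbsFactor_pos {x : ℝ} (hx : 0 < x) (D : Finset (Sym2 V)) : 0 < gibbsFactor x D :=
  pow_pos hx _

theorem empty_mem_dimericConfigs (G : SimpleGraph V) : ∅ ∈ dimericConfigs G := by
  simp [mem_dimericConfigs]

theorem partitionFunction_pos (G : SimpleGraph V) {x : ℝ} (hx : 0 < x) :
    0 < partitionFunction G x :=
  Finset.sum_pos (fun D _ => gibbsFactor_pos hx D) ⟨∅, empty_mem_dimericConfigs G⟩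

-- Isolating `v` instead of removing it keeps the vertex type fixed throughout the recursion. The
-- price is that `v` is then always a monomer and contributes a factor x.
open scoped Classical in
theorem filter_monomers_dimericConfigs (G : SimpleGraph V) (v : V) :
    (dimericConfigs G).filter (fun D => v ∈ monomers D)
      = dimericConfigs (G.deleteIncidenceSet v) := by
  ext D
  simp only [Finset.mem_filter, mem_dimericConfigs, mem_monomers,
    SimpleGraph.edgeSet_deleteIncidenceSet, Set.mem_sdiff, SimpleGraph.incidenceSet,
    Set.mem_ofPred_eq,
    not_and]
  constructor
  · rintro ⟨⟨h1, h2⟩, h3⟩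
    refine ⟨fun e he => ⟨h1 e he, fun _ hv => ?_⟩, h2⟩
    obtain ⟨u, rfl⟩ := Sym2.mem_iff_exists.1 hv
    exact h3 u (by rwa [Sym2.eq_swap])
  · rintro ⟨h1, h2⟩
    exact ⟨⟨fun e he => (h1 e he).1, h2⟩,
      fun u hu => (h1 _ hu).2 (h1 _ hu).1 (Sym2.mem_mk_right u v)⟩

theorem monomerProb_eq_div (G : SimpleGraph V) (x : ℝ) (v : V) :
    monomerProb G x v = partitionFunction (G.deleteIncidenceSet v) x / partitionFunction G x := by
  classical
  rw [monomerProb, gibbsExpectation, partitionFunction.eq_1 (G.deleteIncidenceSet v),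
    ← filter_monomers_dimericConfigs, Finset.sum_div, Finset.sum_filter]
  refine Finset.sum_congr rfl fun D _ => ?_
  split_ifs <;> simp

-- Erasing the edge `s(v, w)` is a bijection onto the configurations that leave both ends uncovered.
-- It creates two new monomers, which accounts for x².
open scoped Classical in
theorem sum_dimericConfigs_mem (G : SimpleGraph V) {x : ℝ} (hx : 0 < x) {v w : V} (h : G.Adj v w) :
    ∑ D ∈ (dimericConfigs G).filter (fun D => s(v, w) ∈ D), gibbsFactor x D
      = partitionFunction ((G.deleteIncidenceSet v).deleteIncidenceSet w) x / x ^ 2 := by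
  have key : ∀ D : Finset (Sym2 V),
      D ∈ dimericConfigs ((G.deleteIncidenceSet v).deleteIncidenceSet w) ↔
        D ∈ dimericConfigs G ∧ v ∈ monomers D ∧ w ∈ monomers D := by
    intro D
    rw [← filter_monomers_dimericConfigs, ← filter_monomers_dimericConfigs, Finset.mem_filter,
      Finset.mem_filter, and_assoc]
  rw [partitionFunction, Finset.sum_div]
  refine Finset.sum_bij' (fun D _ => D.erase s(v, w)) (fun D _ => insert s(v, w) D) ?_ ?_ ?_ ?_ ?_
  · intro D hD
    obtain ⟨hD, hm⟩ := Finset.mem_filter.1 hD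
    have h12 := mem_dimericConfigs.1 hD
    rw [key]
    refine ⟨mem_dimericConfigs.2 ⟨fun e he => h12.1 e (Finset.mem_of_mem_erase he),
      fun e he f hf => h12.2 e (Finset.mem_of_mem_erase he) f (Finset.mem_of_mem_erase hf)⟩,
      mem_monomers.2 fun u hu => ?_, mem_monomers.2 fun u hu => ?_⟩
    · exact (Finset.mem_erase.1 hu).1
        (h12.2 _ (Finset.mem_of_mem_erase hu) _ hm v (by simp) (by simp))
    · exact (Finset.mem_erase.1 hu).1
        (h12.2 _ (Finset.mem_of_mem_erase hu) _ hm w (by simp) (by simp))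
  · intro D hD
    obtain ⟨hD, hv, hw⟩ := (key D).1 hD
    have h12 := mem_dimericConfigs.1 hD
    have hnot : ∀ e ∈ D, ∀ u, u ∈ e → u ∉ s(v, w) := by
      intro e he u hu huv
      obtain ⟨y, rfl⟩ := Sym2.mem_iff_exists.1 hu
      rcases Sym2.mem_iff.1 huv with rfl | rfl
      · exact mem_monomers.1 hv y (by rwa [Sym2.eq_swap])
      · exact mem_monomers.1 hw y (by rwa [Sym2.eq_swap])
    refine Finset.mem_filter.2 ⟨mem_dimericConfigs.2 ⟨?_, ?_⟩, Finset.mem_insert_self _ _⟩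
    · intro e he
      rcases Finset.mem_insert.1 he with rfl | he
      · exact h
      · exact h12.1 e he
    · intro e he f hf u hue huf
      rcases Finset.mem_insert.1 he with rfl | he <;> rcases Finset.mem_insert.1 hf with rfl | hf
      · rfl
      · exact absurd hue (hnot f hf u huf)
      · exact absurd huf (hnot e he u hue)
      · exact h12.2 e he f hf u hue huf
  · intro D hD
    exact Finset.insert_erase (Finset.mem_filter.1 hD).2
  · intro D hD
    refine Finset.erase_insert fun hm => ?_
    exact mem_monomers.1 ((key D).1 hD).2.2 v hm
  · intro D hD
    obtain ⟨hD, hm⟩ := Finset.mem_filter.1 hD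
    have h1 := card_monomers_add G D hD
    have h2 := Finset.card_erase_add_one hm
    rw [gibbsFactor, gibbsFactor, eq_div_iff (by positivity), ← pow_add]
    congr 1
    omega

-- A configuration either leaves `v` uncovered or covers it by exactly one edge.
open scoped Classical in
theorem partitionFunction_eq_add (G : SimpleGraph V) {x : ℝ} (hx : 0 < x) (v : V) :
    partitionFunction G x = partitionFunction (G.deleteIncidenceSet v) x
      + ∑ w with G.Adj v w,
          partitionFunction ((G.deleteIncidenceSet v).deleteIncidenceSet w) x / x ^ 2 := by
  have h1 : ∀ w ∈ Finset.univ.filter (G.Adj v),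
      partitionFunction ((G.deleteIncidenceSet v).deleteIncidenceSet w) x / x ^ 2
        = ∑ D ∈ dimericConfigs G, if s(v, w) ∈ D then gibbsFactor x D else 0 := by
    intro w hw
    rw [← sum_dimericConfigs_mem G hx (by simpa using hw), Finset.sum_filter]
  rw [Finset.sum_congr rfl h1, Finset.sum_comm]
  nth_rewrite 1 [partitionFunction]
  rw [partitionFunction, ← filter_monomers_dimericConfigs, Finset.sum_filter,
    ← Finset.sum_add_distrib]
  refine Finset.sum_congr rfl fun D hD => ?_
  obtain ⟨h1, h2⟩ := mem_dimericConfigs.1 hD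
  split_ifs with hv
  · rw [Finset.sum_eq_zero, add_zero]
    intro w _
    rw [if_neg]
    rw [Sym2.eq_swap]
    exact mem_monomers.1 hv w
  · rw [mem_monomers] at hv
    push Not at hv
    obtain ⟨u, hu⟩ := hv
    rw [Finset.sum_eq_single u, if_pos (by rwa [Sym2.eq_swap]), zero_add]
    · intro w _ hwu
      rw [if_neg]
      intro hw
      apply hwu
      have := h2 _ hw _ hu v (by simp) (by simp)
      rw [Sym2.eq_swap (a := u)] at this
      rcases Sym2.eq_iff.1 this with ⟨_, h⟩ | ⟨h, h'⟩
      exacts [h, h'.trans h]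
    · intro hnot
      have : G.Adj u v := h1 _ hu
      exact absurd (by simpa using this.symm) hnot

-- Dividing `partitionFunction_eq_add` by the partition function with `v` isolated turns each
-- summand into a monomer probability in that smaller graph.
open scoped Classical in
theorem monomerProb_recursion (G : SimpleGraph V) {x : ℝ} (hx : 0 < x) (v : V) :
    monomerProb G x v
      = x ^ 2 / (x ^ 2 + ∑ w with G.Adj v w, monomerProb (G.deleteIncidenceSet v) x w) := by
  simp_rw [monomerProb_eq_div]
  rw [partitionFunction_eq_add G hx v, ← Finset.sum_div, ← Finset.sum_div]
  have h0 := partitionFunction_pos (G.deleteIncidenceSet v) hx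
  have h1 : 0 ≤ ∑ w with G.Adj v w,
      partitionFunction ((G.deleteIncidenceSet v).deleteIncidenceSet w) x :=
    Finset.sum_nonneg fun w _ => (partitionFunction_pos _ hx).le
  field_simp

theorem monomerProb_nonneg (G : SimpleGraph V) {x : ℝ} (hx : 0 < x) (v : V) :
    0 ≤ monomerProb G x v := by
  rw [monomerProb_eq_div]
  exact div_nonneg (partitionFunction_pos _ hx).le (partitionFunction_pos _ hx).le

theorem hasDerivAt_partitionFunction (G : SimpleGraph V) {x : ℝ} (hx : 0 < x) :
    HasDerivAt (partitionFunction G)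
      (∑ D ∈ dimericConfigs G, ((monomers D).card : ℝ) * gibbsFactor x D / x) x := by
  unfold partitionFunction
  refine HasDerivAt.fun_sum fun D hD => ?_
  have h1 := card_monomers_add G D hD
  have h2 : Fintype.card V - 2 * D.card = (monomers D).card := by omega
  unfold gibbsFactor
  rw [h2]
  refine (hasDerivAt_pow (monomers D).card x).congr_deriv ?_
  symm
  rcases Nat.eq_zero_or_pos (monomers D).card with h | h
  · simp [h]
  · rw [mul_div_assoc]
    congr 1
    rw [div_eq_iff hx.ne', ← pow_succ]
    congr 1
    omega

theorem sum_monomerProb (G : SimpleGraph V) (x : ℝ) :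
    ∑ v, monomerProb G x v
      = (∑ D ∈ dimericConfigs G, ((monomers D).card : ℝ) * gibbsFactor x D)
        / partitionFunction G x := by
  classical
  simp only [monomerProb, gibbsExpectation]
  rw [Finset.sum_comm, Finset.sum_div]
  refine Finset.sum_congr rfl fun D _ => ?_
  rw [← Finset.sum_mul, Finset.sum_boole, mul_div_assoc]
  simp

theorem hasDerivAt_pressurePerParticle (G : SimpleGraph V) {x : ℝ} (hx : 0 < x) :
    HasDerivAt (pressurePerParticle G)
      ((∑ v, monomerProb G x v) / Fintype.card V / x) x := by
  have h := ((hasDerivAt_partitionFunction G hx).log (partitionFunction_pos G hx).ne').div_const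
    (Fintype.card V : ℝ)
  refine h.congr_deriv ?_
  rw [sum_monomerProb, ← Finset.sum_div]
  ring

theorem monomerDensity_eq (G : SimpleGraph V) {x : ℝ} (hx : 0 < x) :
    monomerDensity G x = (∑ v, monomerProb G x v) / Fintype.card V := by
  rw [monomerDensity, (hasDerivAt_pressurePerParticle G hx).deriv]
  field_simp

end Recursion

/-! ### The truncated cavity recursion: bounds, locality, complex activity -/

theorem sq_div_antitone {x s t : ℝ} (hx : 0 < x) (hs : 0 ≤ s) (hst : s ≤ t) :
    x ^ 2 / (x ^ 2 + t) ≤ x ^ 2 / (x ^ 2 + s) := by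
  have : 0 < x ^ 2 := by positivity
  gcongr

theorem sq_div_mem {x s : ℝ} (hx : 0 < x) (hs : 0 ≤ s) :
    x ^ 2 / (x ^ 2 + s) ∈ Icc (0 : ℝ) 1 := by
  have : 0 < x ^ 2 := by positivity
  refine ⟨by positivity, ?_⟩
  rw [div_le_one (by positivity)]
  linarith

section Cavity

variable {K : Type*} [Field K] {V W : Type*} [Fintype V] [Fintype W]

open scoped Classical in
/-- The cavity recursion of depth `r`, started from the value `1`. -/
noncomputable def cavity (x : K) : ℕ → SimpleGraph V → V → K
  | 0, _, _ => 1
  | r + 1, G, v =>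
    x ^ 2 / (x ^ 2 + ∑ w with G.Adj v w, cavity x r (G.deleteIncidenceSet v) w)

theorem cavity_mem {x : ℝ} (hx : 0 < x) :
    ∀ (r : ℕ) (G : SimpleGraph V) (v : V), cavity x r G v ∈ Icc (0 : ℝ) 1
  | 0, _, _ => by simp [cavity]
  | r + 1, G, v => by
    rw [cavity]
    exact sq_div_mem hx (Finset.sum_nonneg fun w _ => (cavity_mem hx r _ w).1)

/-- The starting value 1 is an upper bound, and each application of the order-reversing recursion
turns upper bounds into lower bounds and conversely. -/
theorem cavity_bounds_monomerProb {x : ℝ} (hx : 0 < x) (n : ℕ) :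
    ∀ (G : SimpleGraph V) (v : V), monomerProb G x v ≤ cavity x (2 * n) G v ∧
      cavity x (2 * n + 1) G v ≤ monomerProb G x v := by
  have step : ∀ n, (∀ (G : SimpleGraph V) (v : V), monomerProb G x v ≤ cavity x n G v) →
      ∀ (G : SimpleGraph V) (v : V), cavity x (n + 1) G v ≤ monomerProb G x v := by
    intro n h G v
    rw [cavity, monomerProb_recursion G hx]
    exact sq_div_antitone hx (Finset.sum_nonneg fun w _ => monomerProb_nonneg _ hx w)
      (Finset.sum_le_sum fun w _ => h _ w)
  have step' : ∀ n, (∀ (G : SimpleGraph V) (v : V), cavity x n G v ≤ monomerProb G x v) →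
      ∀ (G : SimpleGraph V) (v : V), monomerProb G x v ≤ cavity x (n + 1) G v := by
    intro n h G v
    rw [cavity, monomerProb_recursion G hx]
    exact sq_div_antitone hx (Finset.sum_nonneg fun w _ => (cavity_mem hx _ _ w).1)
      (Finset.sum_le_sum fun w _ => h _ w)
  have main : ∀ (G : SimpleGraph V) (v : V), monomerProb G x v ≤ cavity x (2 * n) G v := by
    induction n with
    | zero =>
      intro G v
      rw [mul_zero, cavity, monomerProb_recursion G hx]
      exact (sq_div_mem hx (Finset.sum_nonneg fun w _ => monomerProb_nonneg _ hx w)).2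
    | succ n ih => exact step' _ (step _ ih)
  exact fun G v => ⟨main G v, step _ main G v⟩

/-- Each level of the recursion isolates an end of some edge and so destroys at least one edge; the
start value 1 is exact once no edge is left. This makes the complex recursion a holomorphic
extension of the monomer probability. -/
theorem cavity_eq_monomerProb {x : ℝ} (hx : 0 < x) (r : ℕ) :
    ∀ (G : SimpleGraph V) (v : V), G.edgeSet.ncard ≤ r → cavity x r G v = monomerProb G x v := by
  classical
  have isolated : ∀ (G : SimpleGraph V) (v : V), (∀ w, ¬ G.Adj v w) → monomerProb G x v = 1 := by
    intro G v h
    rw [monomerProb_recursion G hx, Finset.sum_eq_zero, add_zero, div_self (by positivity)]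
    intro w hw
    exact absurd (Finset.mem_filter.1 hw).2 (h w)
  induction r with
  | zero =>
    intro G v h
    rw [cavity, isolated]
    intro w hw
    have : G.edgeSet = ∅ := (Set.ncard_eq_zero (Set.toFinite _)).1 (by omega)
    have h' : s(v, w) ∈ G.edgeSet := hw
    simp [this] at h'
  | succ r ih =>
    intro G v h
    rw [cavity, monomerProb_recursion G hx]
    congr 2
    refine Finset.sum_congr rfl fun w hw => ih _ _ ?_
    have hw' : s(v, w) ∈ G.edgeSet := (Finset.mem_filter.1 hw).2
    have : (G.deleteIncidenceSet v).edgeSet.ncard < G.edgeSet.ncard := by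
      refine Set.ncard_lt_ncard ?_ (Set.toFinite _)
      rw [SimpleGraph.edgeSet_deleteIncidenceSet]
      refine ⟨Set.sdiff_subset, fun hsub => ?_⟩
      exact (hsub hw').2 ⟨hw', by simp⟩
    omega

theorem closedBall_deleteIncidenceSet_subset {V : Type*} (G : SimpleGraph V) {v w : V}
    (h : G.Adj v w) (r : ℕ) :
    closedBall (G.deleteIncidenceSet v) w r ⊆ closedBall G v (r + 1) := by
  intro u hu
  have h1 : G.edist w u ≤ r := (SimpleGraph.edist_anti (G.deleteIncidenceSet_le v)).trans hu
  have h2 : G.edist v w = 1 := SimpleGraph.edist_eq_one_iff_adj.2 h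
  calc G.edist v u ≤ G.edist v w + G.edist w u := SimpleGraph.edist_triangle
    _ ≤ 1 + r := by rw [h2]; gcongr
    _ = ((r + 1 : ℕ) : ℕ∞) := by push_cast; ring

/-- An embedding of graphs remains one when a vertex and its image are isolated. -/
def deleteIncidenceSetEmbedding {V W : Type*} {H : SimpleGraph W} {G : SimpleGraph V}
    (φ : H ↪g G) (o : W) : H.deleteIncidenceSet o ↪g G.deleteIncidenceSet (φ o) where
  toEmbedding := φ.toEmbedding
  map_rel_iff' := by
    intro a b
    simp [SimpleGraph.deleteIncidenceSet_adj]

/-- The cavity recursion of depth `r` only depends on the ball of radius `r`. -/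
theorem cavity_embedding (x : K) (r : ℕ) :
    ∀ {H : SimpleGraph W} {G : SimpleGraph V} (φ : H ↪g G) (o : W),
      closedBall G (φ o) r ⊆ range φ → cavity x r G (φ o) = cavity x r H o := by
  classical
  induction r with
  | zero => intro H G φ o _; simp [cavity]
  | succ r ih =>
    intro H G φ o hball
    rw [cavity, cavity]
    congr 2
    symm
    refine Finset.sum_nbij φ ?_ φ.injective.injOn ?_ ?_
    · intro w hw
      simpa using hw
    · intro u hu
      have hu' : G.Adj (φ o) u := by simpa using hu
      have : u ∈ closedBall G (φ o) (r + 1) := by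
        rw [closedBall, Set.mem_ofPred_eq, SimpleGraph.edist_eq_one_iff_adj.2 hu']
        exact_mod_cast Nat.le_add_left 1 r
      obtain ⟨w, rfl⟩ := hball this
      exact ⟨w, by simpa using hu', rfl⟩
    · intro w hw
      have hw' : G.Adj (φ o) (φ w) := by simpa using hw
      refine (ih (deleteIncidenceSetEmbedding φ o) w ?_).symm
      exact (closedBall_deleteIncidenceSet_subset G hw' r).trans hball

theorem RootedIso.cavity_eq {H : SimpleGraph W} {G : SimpleGraph V} {o : W} {v : V}
    (h : RootedIso H o G v) (x : K) (r : ℕ) : cavity x r H o = cavity x r G v := by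
  obtain ⟨φ, rfl⟩ := h
  refine (cavity_embedding x r φ.toEmbedding o ?_).symm
  intro u _
  exact φ.surjective u

theorem BallIso.cavity_eq {G : SimpleGraph V} {v : V} {r : ℕ} {T : SimpleGraph W} {o : W}
    (h : BallIso G v r T o) (x : K) : cavity x r G v = cavity x r T o := by
  classical
  have : Fintype (closedBall G v r) := Fintype.ofFinite _
  rw [← RootedIso.cavity_eq h x r]
  refine cavity_embedding x r (SimpleGraph.Embedding.induce (closedBall G v r))
    ⟨v, self_mem_closedBall G v r⟩ ?_
  intro u hu
  exact ⟨⟨u, hu⟩, rfl⟩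

theorem cavity_ofReal (x : ℝ) :
    ∀ (r : ℕ) (G : SimpleGraph V) (v : V), cavity (x : ℂ) r G v = (cavity x r G v : ℝ)
  | 0, _, _ => by simp [cavity]
  | r + 1, G, v => by
    simp [cavity, cavity_ofReal x r]

theorem cavity_denominator_eq {V : Type*} {z : ℂ} (hz : 0 < z.re) (s : Finset V) (f : V → ℂ) :
    z ^ 2 + ∑ w ∈ s, f w = z * (z + ∑ w ∈ s, f w / z) := by
  have hz0 : z ≠ 0 := by rintro rfl; simp at hz
  rw [← Finset.sum_div]
  field_simp

/-- After division by `z` the recursion reads h = 1/(z + ∑ h_w). If all Re h_w ≥ 0, the denominator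
has real part at least Re z, and inversion preserves the right half-plane. -/
theorem cavity_div_bounds {z : ℂ} (hz : 0 < z.re) :
    ∀ (r : ℕ) (G : SimpleGraph V) (v : V),
      0 ≤ (cavity z r G v / z).re ∧ ‖cavity z r G v / z‖ ≤ 1 / z.re := by
  classical
  have inv : ∀ w : ℂ, z.re ≤ w.re → 0 ≤ (1 / w).re ∧ ‖1 / w‖ ≤ 1 / z.re := by
    intro w hw
    constructor
    · rw [one_div, Complex.inv_re]
      exact div_nonneg (hz.le.trans hw) (Complex.normSq_nonneg _)
    · rw [norm_div, norm_one]
      exact one_div_le_one_div_of_le hz (hw.trans (Complex.re_le_norm w))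
  have hz0 : z ≠ 0 := by rintro rfl; simp at hz
  intro r
  induction r with
  | zero => intro G v; exact inv z le_rfl
  | succ r ih =>
    intro G v
    rw [cavity, cavity_denominator_eq hz, pow_two, mul_div_mul_left _ _ hz0, div_right_comm,
      div_self hz0]
    refine inv _ ?_
    rw [Complex.add_re, Complex.re_sum]
    exact le_add_of_nonneg_right (Finset.sum_nonneg fun w _ => (ih _ w).1)

theorem differentiableOn_cavity (r : ℕ) :
    ∀ (G : SimpleGraph V) (v : V),
      DifferentiableOn ℂ (fun z : ℂ => cavity z r G v) {z | 0 < z.re} := by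
  classical
  induction r with
  | zero => intro G v; exact differentiableOn_const _
  | succ r ih =>
    intro G v
    simp only [cavity]
    refine DifferentiableOn.div (by fun_prop) ?_ ?_
    · exact (by fun_prop : DifferentiableOn ℂ (fun z : ℂ => z ^ 2) _).add
        (DifferentiableOn.fun_sum fun w _ => ih _ w)
    · intro z hz
      have hz0 : z ≠ 0 := by rintro rfl; simp at hz
      rw [cavity_denominator_eq hz]
      refine mul_ne_zero hz0 fun h0 => ?_
      have h1 := congrArg Complex.re h0
      rw [Complex.add_re, Complex.re_sum, Complex.zero_re] at h1
      have h2 := Finset.sum_nonneg fun w (_ : w ∈ Finset.univ.filter (G.Adj v)) =>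
        (cavity_div_bounds hz r (G.deleteIncidenceSet v) w).1
      have h3 : 0 < z.re := hz
      linarith

end Cavity

/-! ### Galton–Watson trees as graphs on words -/

section GaltonWatson

/-- The offspring numbers in the subtree of the `i`-th child of the root. -/
def subtreeOffspring (k : List ℕ → ℕ) (i : ℕ) : List ℕ → ℕ := fun u => k (i :: u)

theorem cons_mem_gwNodes {k : List ℕ → ℕ} {i : ℕ} {u : List ℕ} :
    i :: u ∈ gwNodes k ↔ i < k [] ∧ u ∈ gwNodes (subtreeOffspring k i) := by
  constructor
  · intro h
    refine ⟨h [] i (by simp), fun w j hw => h (i :: w) j (by simpa using hw)⟩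
  · rintro ⟨h1, h2⟩ w j hw
    cases w with
    | nil =>
      have : j = i := by simpa using hw
      exact this ▸ h1
    | cons a w =>
      simp only [List.cons_append, List.cons_prefix_cons] at hw
      obtain ⟨rfl, hw⟩ := hw
      exact h2 w j hw

theorem cons_mem_gwNodesUpTo {k : List ℕ → ℕ} {r i : ℕ} {u : List ℕ} :
    i :: u ∈ gwNodesUpTo k (r + 1) ↔ i < k [] ∧ u ∈ gwNodesUpTo (subtreeOffspring k i) r := by
  simp [gwNodesUpTo, cons_mem_gwNodes, and_assoc]

theorem finite_gwNodesUpTo (r : ℕ) : ∀ k : List ℕ → ℕ, (gwNodesUpTo k r).Finite := by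
  induction r with
  | zero =>
    intro k
    refine (Set.finite_singleton []).subset fun u hu => ?_
    simpa using hu.2
  | succ r ih =>
    intro k
    refine ((Set.finite_singleton []).union ((Set.finite_lt_nat (k [])).biUnion
      fun i _ => (ih (subtreeOffspring k i)).image (List.cons i))).subset ?_
    rintro (_ | ⟨i, u⟩) hu
    · simp
    · rw [cons_mem_gwNodesUpTo] at hu
      refine Or.inr (Set.mem_biUnion (show i ∈ {j | j < k []} from hu.1) ⟨u, hu.2, rfl⟩)

noncomputable instance fintypeGwNodesUpTo (k : List ℕ → ℕ) (r : ℕ) : Fintype (gwNodesUpTo k r) :=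
  (finite_gwNodesUpTo r k).fintype

theorem gwNodesUpTo_of_append {k : List ℕ → ℕ} {r : ℕ} {u w : List ℕ}
    (h : u ++ w ∈ gwNodesUpTo k r) : u ∈ gwNodesUpTo k r :=
  ⟨fun v i hv => h.1 v i (hv.trans (List.prefix_append u w)), by
    have := h.2
    rw [List.length_append] at this
    omega⟩

theorem mem_of_reachable {V : Type*} {G : SimpleGraph V} {S : Set V}
    (hS : ∀ a ∈ S, ∀ b, G.Adj a b → b ∈ S) {a b : V} (ha : a ∈ S) (h : G.Reachable a b) :
    b ∈ S := by
  obtain ⟨p⟩ := h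
  induction p with
  | nil => exact ha
  | cons hadj _ ih => exact ih (hS _ ha _ hadj)

theorem isAcyclic_wordGraph : wordGraph.IsAcyclic := by
  have key : ∀ (u : List ℕ) (i : ℕ), wordGraph.IsBridge s(u, u ++ [i]) := by
    intro u i
    rw [SimpleGraph.isBridge_iff]
    intro hr
    -- Once the edge to its parent is deleted, the descendants of `u ++ [i]` are closed under
    -- adjacency; a path to `u` would make `u` one of them, against its length.
    have : u ∈ {w : List ℕ | u ++ [i] <+: w} := by
      refine mem_of_reachable ?_ (List.prefix_rfl) hr.symm
      rintro a ha b hab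
      rw [SimpleGraph.deleteEdges_adj] at hab
      obtain ⟨⟨j, rfl⟩ | ⟨j, rfl⟩, hne⟩ := hab
      · exact List.IsPrefix.trans ha (List.prefix_append a [j])
      · rcases List.prefix_concat_iff.1 ha with h | h
        · obtain ⟨rfl, h⟩ := List.append_inj' h rfl
          obtain rfl : i = j := by simpa using h
          exact absurd (Sym2.eq_swap) hne
        · exact h
    have h := List.IsPrefix.length_le this
    simp at h
  rw [SimpleGraph.isAcyclic_iff_forall_adj_isBridge]
  rintro v w (⟨i, rfl⟩ | ⟨i, rfl⟩)
  · exact key v i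
  · rw [Sym2.eq_swap]
    exact key w i

theorem exists_walk_gwRoot (k : List ℕ → ℕ) (r : ℕ) (u : List ℕ) :
    ∀ hu : u ∈ gwNodesUpTo k r,
      ∃ p : (gwTree k r).Walk (gwRoot k r) ⟨u, hu⟩, p.length = u.length := by
  induction u using List.reverseRecOn with
  | nil => intro _; exact ⟨SimpleGraph.Walk.nil, rfl⟩
  | append_singleton u i ih =>
    intro hu
    obtain ⟨p, hp⟩ := ih (gwNodesUpTo_of_append hu)
    refine ⟨p.concat (show (gwTree k r).Adj _ _ from Or.inl ⟨i, rfl⟩), ?_⟩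
    simp [hp]

theorem isTree_gwTree (k : List ℕ → ℕ) (r : ℕ) : (gwTree k r).IsTree := by
  refine ⟨?_, isAcyclic_wordGraph.induce _⟩
  rw [SimpleGraph.connected_iff_exists_forall_reachable]
  exact ⟨gwRoot k r, fun u => let ⟨p, _⟩ := exists_walk_gwRoot k r u.1 u.2; ⟨p⟩⟩

theorem edist_gwRoot_le (k : List ℕ → ℕ) (r : ℕ) (u : gwNodesUpTo k r) :
    (gwTree k r).edist (gwRoot k r) u ≤ r := by
  obtain ⟨p, hp⟩ := exists_walk_gwRoot k r u.1 u.2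
  refine p.edist_le.trans ?_
  rw [hp]
  exact_mod_cast u.2.2

/-- The value at the root of the cavity recursion of depth `r` on the tree with offspring
numbers `k`. -/
noncomputable def gwCavity (x : ℝ) : ℕ → (List ℕ → ℕ) → ℝ
  | 0, _ => 1
  | r + 1, k => x ^ 2 / (x ^ 2 + ∑ i ∈ Finset.range (k []), gwCavity x r (subtreeOffspring k i))

/-- The tree of the descendants of the `i`-th child of the root, in the tree with isolated root. -/
def subtreeEmbedding (k : List ℕ → ℕ) (r : ℕ) {i : ℕ} (hi : i < k []) :
    gwTree (subtreeOffspring k i) r ↪g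
      (gwTree k (r + 1)).deleteIncidenceSet (gwRoot k (r + 1)) where
  toFun u := ⟨i :: u.1, cons_mem_gwNodesUpTo.2 ⟨hi, u.2⟩⟩
  inj' u v h := by
    have := congrArg Subtype.val h
    exact Subtype.ext (List.cons.inj this).2
  map_rel_iff' := by
    intro u v
    rw [SimpleGraph.deleteIncidenceSet_adj]
    constructor
    · rintro ⟨⟨j, h⟩ | ⟨j, h⟩, -⟩
      · exact Or.inl ⟨j, (List.cons.inj h).2⟩
      · exact Or.inr ⟨j, (List.cons.inj h).2⟩
    · intro h
      refine ⟨?_, fun h => List.cons_ne_nil _ _ (congrArg Subtype.val h),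
        fun h => List.cons_ne_nil _ _ (congrArg Subtype.val h)⟩
      rcases h with ⟨j, h⟩ | ⟨j, h⟩
      · exact Or.inl ⟨j, congrArg (List.cons i) h⟩
      · exact Or.inr ⟨j, congrArg (List.cons i) h⟩

theorem cavity_gwTree (x : ℝ) (r : ℕ) :
    ∀ k : List ℕ → ℕ, cavity x r (gwTree k r) (gwRoot k r) = gwCavity x r k := by
  classical
  induction r with
  | zero => intro k; rfl
  | succ r ih =>
    intro k
    rw [cavity, gwCavity]
    congr 2
    symm
    refine Finset.sum_bij (fun i hi => subtreeEmbedding k r (Finset.mem_range.1 hi) (gwRoot _ r))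
      ?_ ?_ ?_ ?_
    · intro i hi
      rw [Finset.mem_filter]
      exact ⟨Finset.mem_univ _, Or.inl ⟨i, rfl⟩⟩
    · intro i hi j hj h
      have := congrArg Subtype.val h
      exact (List.cons.inj this).1
    · rintro ⟨u, hu⟩ h
      rcases (Finset.mem_filter.1 h).2 with ⟨i, hi⟩ | ⟨i, hi⟩
      · have hi' : u = [i] := hi
        subst hi'
        exact ⟨i, Finset.mem_range.2 (cons_mem_gwNodesUpTo.1 hu).1, rfl⟩
      · simp [gwRoot] at hi
    · intro i hi
      rw [← ih]
      refine (cavity_embedding x r (subtreeEmbedding k r (Finset.mem_range.1 hi)) _ ?_).symm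
      -- With the root isolated, the descendants of child `i` are closed under adjacency, so a ball
      -- around that child cannot leave them, whatever its radius.
      intro u hu
      refine mem_of_reachable ?_ (mem_range_self (gwRoot (subtreeOffspring k i) r))
        (SimpleGraph.reachable_of_edist_ne_top (ne_top_of_le_ne_top (ENat.natCast_ne_top r) hu))
      rintro _ ⟨a, rfl⟩ ⟨b, hb⟩ hab
      rw [SimpleGraph.deleteIncidenceSet_adj] at hab
      obtain ⟨hab, -, hne⟩ := hab
      rcases hab with ⟨j, hj⟩ | ⟨j, hj⟩
      · have hj' : b = i :: (a.1 ++ [j]) := hj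
        subst hj'
        exact ⟨⟨_, (cons_mem_gwNodesUpTo.1 hb).2⟩, rfl⟩
      · have hj' : i :: a.1 = b ++ [j] := hj
        cases b with
        | nil => exact absurd rfl hne
        | cons c b =>
          simp only [List.cons_append, List.cons.injEq] at hj'
          obtain ⟨rfl, -⟩ := hj'
          exact ⟨⟨b, (cons_mem_gwNodesUpTo.1 hb).2⟩, rfl⟩

end GaltonWatson

/-! ### Reindexing and splitting infinite product measures -/

section ProductMeasure

variable {ι κ X : Type*} [MeasurableSpace X]

theorem infinitePi_map_comp (μ : ι → Measure X) [∀ i, IsProbabilityMeasure (μ i)] {e : κ → ι}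
    (he : Function.Injective e) :
    (Measure.infinitePi μ).map (fun f j => f (e j)) = Measure.infinitePi fun j => μ (e j) := by
  classical
  refine Measure.eq_infinitePi _ fun s t ht => ?_
  rw [Measure.map_apply (by fun_prop) (.pi s.countable_toSet fun _ _ => ht _)]
  have hset : (fun (f : ι → X) j => f (e j)) ⁻¹' ((s : Set κ).pi t) =
      ((s.image e : Finset ι) : Set ι).pi (Function.extend e t fun _ => univ) := by
    ext f
    simp [Set.mem_pi, he.extend_apply]
  rw [hset, Measure.infinitePi_pi, Finset.prod_image he.injOn]
  · simp [he.extend_apply]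
  · intro i hi
    obtain ⟨j, -, rfl⟩ := Finset.mem_image.1 hi
    rw [he.extend_apply]
    exact ht j

theorem prod_infinitePi_map_option (μ : Option κ → Measure X) [∀ i, IsProbabilityMeasure (μ i)] :
    ((μ none).prod (Measure.infinitePi fun j => μ (some j))).map
      (fun p (i : Option κ) => i.elim p.1 p.2) = Measure.infinitePi μ := by
  classical
  have hmeas : Measurable fun (p : X × (κ → X)) (i : Option κ) => i.elim p.1 p.2 := by
    refine measurable_pi_lambda _ fun i => ?_
    cases i <;> simp only [Option.elim] <;> fun_prop
  refine Measure.eq_infinitePi _ fun s t ht => ?_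
  rw [Measure.map_apply hmeas (.pi s.countable_toSet fun _ _ => ht _)]
  have hset : (fun (p : X × (κ → X)) (i : Option κ) => i.elim p.1 p.2) ⁻¹'
      ((s : Set (Option κ)).pi t)
      = (if none ∈ s then t none else univ) ×ˢ ((s.eraseNone : Set κ).pi fun j => t (some j)) := by
    ext p
    simp only [mem_preimage, Set.mem_pi, Finset.mem_coe, Option.forall, Option.elim, mem_prod,
      Finset.mem_eraseNone]
    split_ifs with h <;> simp [h]
  rw [hset, Measure.prod_prod, Measure.infinitePi_pi _ fun j _ => ht _]
  by_cases h : none ∈ s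
  · have hs : s = Finset.insertNone s.eraseNone := by
      rw [Finset.insertNone_eraseNone, Finset.insert_eq_of_mem h]
    rw [if_pos h]
    conv_rhs => rw [hs]
    rw [Finset.prod_insertNone]
  · have hs : s = s.eraseNone.map Function.Embedding.some := by
      rw [Finset.map_some_eraseNone, Finset.erase_eq_of_notMem h]
    rw [if_neg h, measure_univ, one_mul]
    conv_rhs => rw [hs]
    rw [Finset.prod_map]
    rfl

/-- A coordinate and a disjoint family of coordinates of a product measure are independent. -/
theorem infinitePi_map_prodMk (μ : ι → Measure X) [∀ i, IsProbabilityMeasure (μ i)] {e : κ → ι}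
    (he : Function.Injective e) {a : ι} (ha : a ∉ range e) :
    (Measure.infinitePi μ).map (fun f => (f a, fun j => f (e j)))
      = (μ a).prod (Measure.infinitePi fun j => μ (e j)) := by
  -- Adjoining `a` as the value at `none` makes one injective family out of the coordinate and the
  -- family, so the claim becomes a reindexing.
  have he' : Function.Injective fun i : Option κ => i.elim a e := by
    rintro (_ | i) (_ | j) h
    · rfl
    · exact absurd ⟨j, h.symm⟩ ha
    · exact absurd ⟨i, h⟩ ha
    · exact congrArg some (he h)
  have hmeas : Measurable fun (p : X × (κ → X)) (i : Option κ) => i.elim p.1 p.2 := by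
    refine measurable_pi_lambda _ fun i => ?_
    cases i <;> simp only [Option.elim] <;> fun_prop
  have h1 := infinitePi_map_comp μ he'
  rw [← prod_infinitePi_map_option (fun i : Option κ => μ (i.elim a e))] at h1
  have h2 := congrArg (Measure.map fun f : Option κ → X => (f none, fun j => f (some j))) h1
  rw [Measure.map_map (by fun_prop) (by fun_prop), Measure.map_map (by fun_prop) hmeas] at h2
  simpa [Function.comp_def] using h2

end ProductMeasure

/-! ### Branching property and the monotone limits on the random tree -/

section TreeMeasure

instance isProbabilityMeasure_gwMeasure (P ρ : PMF ℕ) : IsProbabilityMeasure (gwMeasure P ρ) := by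
  unfold gwMeasure
  infer_instance

/-- The branching property: words split into the empty word and the pairs (first letter, remainder),
so currying the product measure gives independent subtrees, in which every individual has offspring
law `ρ`. -/
theorem gwMeasure_map (P ρ : PMF ℕ) :
    (gwMeasure P ρ).map (fun k => (k [], subtreeOffspring k))
      = P.toMeasure.prod (Measure.infinitePi fun _ : ℕ => gwMeasure ρ ρ) := by
  have h := infinitePi_map_prodMk (fun u : List ℕ => (if u = [] then P else ρ).toMeasure)
    (e := fun p : ℕ × List ℕ => p.1 :: p.2) (a := [])
    (by rintro ⟨i, u⟩ ⟨j, v⟩ h; simpa using h) (by simp)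
  have h' := congrArg (Measure.map (Prod.map id (MeasurableEquiv.curry ℕ (List ℕ) ℕ))) h
  rw [Measure.map_map (by fun_prop) (by fun_prop),
    ← Measure.map_prod_map _ _ (by fun_prop) (by fun_prop)] at h'
  simp only [reduceCtorEq, if_false, if_true, Measure.map_id] at h'
  rw [Measure.infinitePi_map_curry (fun (_ : ℕ) (_ : List ℕ) => ρ.toMeasure)] at h'
  simp only [gwMeasure, ite_self]
  exact h'

theorem measurable_subtreeOffspring : Measurable subtreeOffspring := by
  unfold subtreeOffspring
  fun_prop

/-- The law of a functional given by the recursion at the root. -/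
theorem map_gwMeasure_recursion (P ρ : PMF ℕ) (x : ℝ) {Y W : (List ℕ → ℕ) → ℝ} (hY : Measurable Y)
    (hW : ∀ k, W k = x ^ 2 / (x ^ 2 + ∑ i ∈ Finset.range (k []), Y (subtreeOffspring k i)))
    (μ : ProbabilityMeasure ℝ) (hμ : (μ : Measure ℝ) = (gwMeasure ρ ρ).map Y) :
    (gwMeasure P ρ).map W = recursionLaw P x μ := by
  have hWeq : W = (fun p : ℕ × (ℕ → ℝ) => x ^ 2 / (x ^ 2 + ∑ i ∈ Finset.range p.1, p.2 i)) ∘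
      (Prod.map id fun (κ : ℕ → List ℕ → ℕ) i => Y (κ i)) ∘
        fun k => (k [], subtreeOffspring k) := by
    ext k
    simp [hW]
  have h1 : Measurable fun (κ : ℕ → List ℕ → ℕ) i => Y (κ i) := by fun_prop
  have h2 : Measurable fun k : List ℕ → ℕ => (k [], subtreeOffspring k) :=
    (measurable_pi_apply []).prodMk measurable_subtreeOffspring
  rw [hWeq, ← Measure.map_map (measurable_recursion x) ((measurable_id.prodMap h1).comp h2),
    ← Measure.map_map (measurable_id.prodMap h1) h2, gwMeasure_map, ← Measure.map_prod_map _ _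
    measurable_id h1, Measure.map_id, Measure.infinitePi_map_pi _ fun _ => hY, recursionLaw]
  simp_rw [hμ]

theorem measurable_recursion_comp (x : ℝ) {Y : (List ℕ → ℕ) → ℝ} (hY : Measurable Y) :
    Measurable fun k : List ℕ → ℕ =>
      x ^ 2 / (x ^ 2 + ∑ i ∈ Finset.range (k []), Y (subtreeOffspring k i)) := by
  have h : Measurable fun k : List ℕ → ℕ => (k [], fun i => Y (subtreeOffspring k i)) := by
    refine (measurable_pi_apply []).prodMk (measurable_pi_lambda _ fun i => hY.comp ?_)
    exact (measurable_pi_apply i).comp measurable_subtreeOffspring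
  exact (measurable_recursion x).comp h

theorem measurable_gwCavity (x : ℝ) : ∀ r : ℕ, Measurable (gwCavity x r)
  | 0 => measurable_const
  | r + 1 => measurable_recursion_comp x (measurable_gwCavity x r)

theorem gwCavity_mem {x : ℝ} (hx : 0 < x) :
    ∀ (r : ℕ) (k : List ℕ → ℕ), gwCavity x r k ∈ Icc (0 : ℝ) 1
  | 0, _ => by simp [gwCavity]
  | r + 1, k => by
    rw [gwCavity]
    exact sq_div_mem hx (Finset.sum_nonneg fun i _ => (gwCavity_mem hx r _).1)

theorem gwCavity_succ_le {x : ℝ} (hx : 0 < x) {m n : ℕ}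
    (h : ∀ k, gwCavity x m k ≤ gwCavity x n k) (k : List ℕ → ℕ) :
    gwCavity x (n + 1) k ≤ gwCavity x (m + 1) k := by
  rw [gwCavity, gwCavity]
  exact sq_div_antitone hx (Finset.sum_nonneg fun i _ => (gwCavity_mem hx m _).1)
    (Finset.sum_le_sum fun i _ => h _)

theorem gwCavity_even_antitone {x : ℝ} (hx : 0 < x) (k : List ℕ → ℕ) :
    Antitone fun n => gwCavity x (2 * n) k := by
  have h : ∀ n k, gwCavity x (2 * (n + 1)) k ≤ gwCavity x (2 * n) k := by
    intro n
    induction n with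
    | zero => intro k; exact (gwCavity_mem hx 2 k).2
    | succ n ih => exact gwCavity_succ_le hx (gwCavity_succ_le hx ih)
  exact antitone_nat_of_succ_le fun n => h n k

theorem gwCavity_odd_monotone {x : ℝ} (hx : 0 < x) (k : List ℕ → ℕ) :
    Monotone fun n => gwCavity x (2 * n + 1) k :=
  fun _ _ hmn => gwCavity_succ_le hx (fun k => gwCavity_even_antitone hx k hmn) k

theorem gwCavity_odd_le_even {x : ℝ} (hx : 0 < x) (n : ℕ) :
    ∀ k : List ℕ → ℕ, gwCavity x (2 * n + 1) k ≤ gwCavity x (2 * n) k := by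
  induction n with
  | zero => intro k; exact (gwCavity_mem hx 1 k).2
  | succ n ih =>
    intro k
    exact gwCavity_succ_le hx (gwCavity_succ_le hx ih) k

/-- The decreasing limit of the cavity recursions of even depth. -/
noncomputable def gwUpper (x : ℝ) (k : List ℕ → ℕ) : ℝ := ⨅ n, gwCavity x (2 * n) k

/-- The increasing limit of the cavity recursions of odd depth. -/
noncomputable def gwLower (x : ℝ) (k : List ℕ → ℕ) : ℝ := ⨆ n, gwCavity x (2 * n + 1) k

theorem tendsto_gwUpper {x : ℝ} (hx : 0 < x) (k : List ℕ → ℕ) :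
    Tendsto (fun n => gwCavity x (2 * n) k) atTop (𝓝 (gwUpper x k)) :=
  tendsto_atTop_ciInf (gwCavity_even_antitone hx k)
    ⟨0, by rintro _ ⟨n, rfl⟩; exact (gwCavity_mem hx _ k).1⟩

theorem tendsto_gwLower {x : ℝ} (hx : 0 < x) (k : List ℕ → ℕ) :
    Tendsto (fun n => gwCavity x (2 * n + 1) k) atTop (𝓝 (gwLower x k)) :=
  tendsto_atTop_ciSup (gwCavity_odd_monotone hx k)
    ⟨1, by rintro _ ⟨n, rfl⟩; exact (gwCavity_mem hx _ k).2⟩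

theorem gwLower_le_gwUpper {x : ℝ} (hx : 0 < x) (k : List ℕ → ℕ) : gwLower x k ≤ gwUpper x k :=
  le_of_tendsto_of_tendsto' (tendsto_gwLower hx k) (tendsto_gwUpper hx k)
    fun n => gwCavity_odd_le_even hx n k

theorem gwUpper_mem {x : ℝ} (hx : 0 < x) (k : List ℕ → ℕ) : gwUpper x k ∈ Icc (0 : ℝ) 1 :=
  isClosed_Icc.mem_of_tendsto (tendsto_gwUpper hx k)
    (Eventually.of_forall fun _ => gwCavity_mem hx _ k)

theorem gwLower_mem {x : ℝ} (hx : 0 < x) (k : List ℕ → ℕ) : gwLower x k ∈ Icc (0 : ℝ) 1 :=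
  isClosed_Icc.mem_of_tendsto (tendsto_gwLower hx k)
    (Eventually.of_forall fun _ => gwCavity_mem hx _ k)

theorem measurable_gwUpper {x : ℝ} (hx : 0 < x) : Measurable (gwUpper x) :=
  measurable_of_tendsto_metrizable (fun n => measurable_gwCavity x (2 * n))
    (tendsto_pi_nhds.2 fun k => tendsto_gwUpper hx k)

theorem measurable_gwLower {x : ℝ} (hx : 0 < x) : Measurable (gwLower x) :=
  measurable_of_tendsto_metrizable (fun n => measurable_gwCavity x (2 * n + 1))
    (tendsto_pi_nhds.2 fun k => tendsto_gwLower hx k)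

theorem tendsto_recursion {x : ℝ} (hx : 0 < x) (k : List ℕ → ℕ) {f : ℕ → (List ℕ → ℕ) → ℝ}
    {g : (List ℕ → ℕ) → ℝ} (hf : ∀ k, Tendsto (fun n => f n k) atTop (𝓝 (g k)))
    (hg : ∀ k, 0 ≤ g k) :
    Tendsto (fun n => x ^ 2 / (x ^ 2 + ∑ i ∈ Finset.range (k []), f n (subtreeOffspring k i)))
      atTop (𝓝 (x ^ 2 / (x ^ 2 + ∑ i ∈ Finset.range (k []), g (subtreeOffspring k i)))) := by
  refine tendsto_const_nhds.div (tendsto_const_nhds.add (tendsto_finsetSum _ fun i _ => hf _)) ?_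
  have := Finset.sum_nonneg fun i (_ : i ∈ Finset.range (k [])) => hg (subtreeOffspring k i)
  positivity

theorem gwLower_recursion {x : ℝ} (hx : 0 < x) (k : List ℕ → ℕ) :
    gwLower x k
      = x ^ 2 / (x ^ 2 + ∑ i ∈ Finset.range (k []), gwUpper x (subtreeOffspring k i)) :=
  tendsto_nhds_unique (tendsto_gwLower hx k)
    (tendsto_recursion hx k (tendsto_gwUpper hx) fun k => (gwUpper_mem hx k).1)

theorem gwUpper_recursion {x : ℝ} (hx : 0 < x) (k : List ℕ → ℕ) :
    gwUpper x k
      = x ^ 2 / (x ^ 2 + ∑ i ∈ Finset.range (k []), gwLower x (subtreeOffspring k i)) :=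
  tendsto_nhds_unique ((tendsto_gwUpper hx k).comp (tendsto_add_atTop_nat 1))
    (tendsto_recursion hx k (tendsto_gwLower hx) fun k => (gwLower_mem hx k).1)

end TreeMeasure

/-! ### Balance along an edge from unimodularity -/

section Balance

theorem ae_infinitePi_mem {S : Type*} [MeasurableSpace S] {μ : Measure S} [IsProbabilityMeasure μ]
    {s : Set S} (h : μ sᶜ = 0) :
    ∀ᵐ X ∂Measure.infinitePi fun _ : ℕ => μ, ∀ i, X i ∈ s := by
  rw [ae_all_iff]
  intro i
  exact (measurePreserving_eval_infinitePi (fun _ : ℕ => μ) i).quasiMeasurePreserving.ae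
    (p := fun y => y ∈ s) h

/-- The coordinates are exchangeable: swap `i` with 0 and split off the first coordinate. -/
theorem lintegral_share_eq {μ : Measure ℝ} [IsProbabilityMeasure μ] (x : ℝ) {m i : ℕ}
    (hi : i < m + 1) :
    ∫⁻ X, ENNReal.ofReal (X i / (x ^ 2 + ∑ j ∈ Finset.range (m + 1), X j))
        ∂(Measure.infinitePi fun _ : ℕ => μ)
      = ∫⁻ p, ENNReal.ofReal (p.1 / (x ^ 2 + (p.1 + ∑ j ∈ Finset.range m, p.2 j)))
        ∂(μ.prod (Measure.infinitePi fun _ : ℕ => μ)) := by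
  have h1 := infinitePi_map_comp (fun _ : ℕ => μ) (Equiv.swap 0 i).injective
  have h2 := infinitePi_map_prodMk (fun _ : ℕ => μ) Nat.succ_injective (a := 0) (by simp)
  rw [← h2, lintegral_map (by fun_prop) (by fun_prop)]
  conv_rhs => rw [← h1]
  rw [lintegral_map (by fun_prop) (by fun_prop)]
  refine lintegral_congr fun X => ?_
  simp only [Equiv.swap_apply_left, Nat.succ_eq_add_one]
  congr 3
  · have h3 := Equiv.Perm.sum_comp (Equiv.swap 0 i) (Finset.range (m + 1)) X (by
      intro a ha
      have : a = 0 ∨ a = i := by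
        by_contra hne
        push Not at hne
        exact ha (Equiv.swap_apply_of_ne_of_ne hne.1 hne.2)
      rcases this with rfl | rfl
      · simp
      · simpa using hi)
    rw [← h3, Finset.sum_range_succ', Equiv.swap_apply_left, add_comm]

/-- With S the sum of the messages, 1 − x²/(x²+S) = ∑ X_i/(x²+S), and the `m + 1` shares have equal
means. -/
theorem lintegral_one_sub_eq {μ : Measure ℝ} [IsProbabilityMeasure μ] {x : ℝ} (hx : 0 < x)
    (hμ : μ (Icc (0 : ℝ) 1)ᶜ = 0) (m : ℕ) :
    ∫⁻ X, ENNReal.ofReal (1 - x ^ 2 / (x ^ 2 + ∑ j ∈ Finset.range (m + 1), X j))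
        ∂(Measure.infinitePi fun _ : ℕ => μ)
      = ((m + 1 : ℕ) : ℝ≥0∞)
        * ∫⁻ p, ENNReal.ofReal (p.1 / (x ^ 2 + (p.1 + ∑ j ∈ Finset.range m, p.2 j)))
          ∂(μ.prod (Measure.infinitePi fun _ : ℕ => μ)) := by
  calc _ = ∫⁻ X, ∑ i ∈ Finset.range (m + 1),
          ENNReal.ofReal (X i / (x ^ 2 + ∑ j ∈ Finset.range (m + 1), X j))
          ∂(Measure.infinitePi fun _ : ℕ => μ) := by
        refine lintegral_congr_ae ?_
        filter_upwards [ae_infinitePi_mem hμ] with X hX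
        have hs : 0 ≤ ∑ j ∈ Finset.range (m + 1), X j := Finset.sum_nonneg fun i _ => (hX i).1
        rw [← ENNReal.ofReal_sum_of_nonneg]
        · congr 1
          rw [← Finset.sum_div]
          field_simp
          ring
        · intro i _
          have := (hX i).1
          positivity
    _ = _ := by
        rw [lintegral_finsetSum _ fun i _ => by fun_prop]
        rw [Finset.sum_congr rfl fun i hi => lintegral_share_eq x (Finset.mem_range.1 hi)]
        simp

theorem lintegral_pmf_prod (D : PMF ℕ) {α : Type*} [MeasurableSpace α] (κ : Measure α) [SFinite κ]
    {f : ℕ × α → ℝ≥0∞} (hf : Measurable f) :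
    ∫⁻ p, f p ∂(D.toMeasure.prod κ) = ∑' n, D n * ∫⁻ a, f (n, a) ∂κ := by
  rw [lintegral_prod _ hf.aemeasurable, lintegral_countable']
  refine tsum_congr fun n => ?_
  rw [PMF.toMeasure_apply_singleton _ _ (measurableSet_singleton n), mul_comm]

theorem mean_ne_zero {P ρ : PMF ℕ} (h : IsUnimodular P ρ) :
    ∑' j : ℕ, (j : ℝ≥0∞) * P j ≠ 0 := by
  intro h0
  have h1 : ∀ k, ρ k = 0 := by
    intro k
    rw [h.2 k]
    have := ENNReal.tsum_eq_zero.1 h0 (k + 1)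
    rw [this, ENNReal.zero_div]
  have h2 := ρ.tsum_coe
  simp [h1] at h2

/-- The mean number of edges covering the root, in terms of the two messages along an edge. -/
theorem lintegral_one_sub_recursionLaw {P ρ : PMF ℕ} (h : IsUnimodular P ρ) {x : ℝ} (hx : 0 < x)
    (μ : ProbabilityMeasure ℝ) (hμ : (μ : Measure ℝ) (Icc (0 : ℝ) 1)ᶜ = 0) :
    ∫⁻ y, ENNReal.ofReal (1 - y) ∂(recursionLaw P x μ)
      = (∑' j : ℕ, (j : ℝ≥0∞) * P j) * ∫⁻ a, ∫⁻ b, ENNReal.ofReal (a * b / (x ^ 2 + a * b))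
          ∂(recursionLaw ρ x μ) ∂(μ : Measure ℝ) := by
  set κ := Measure.infinitePi fun _ : ℕ => (μ : Measure ℝ) with hκ
  set C := ∑' j : ℕ, (j : ℝ≥0∞) * P j with hC
  set I : ℕ → ℝ≥0∞ := fun m => ∫⁻ p, ENNReal.ofReal
    (p.1 / (x ^ 2 + (p.1 + ∑ j ∈ Finset.range m, p.2 j))) ∂((μ : Measure ℝ).prod κ) with hI
  have hL : ∫⁻ y, ENNReal.ofReal (1 - y) ∂(recursionLaw P x μ)
      = ∑' m : ℕ, P (m + 1) * (((m + 1 : ℕ) : ℝ≥0∞) * I m) := by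
    rw [recursionLaw, lintegral_map (by fun_prop) (measurable_recursion x),
      lintegral_pmf_prod P _ (by have := measurable_recursion x; fun_prop),
      tsum_eq_zero_add' ENNReal.summable]
    -- A childless root contributes nothing, so the sum starts at degree one and lines up with the
    -- shift by one between `P` and `ρ`.
    have h0 : ENNReal.ofReal (1 - x ^ 2 / (x ^ 2 + 0)) = 0 := by
      rw [add_zero, div_self (by positivity)]
      simp
    simp only [Finset.range_zero, Finset.sum_empty, h0, lintegral_zero, mul_zero, zero_add]
    refine tsum_congr fun m => ?_
    rw [lintegral_one_sub_eq hx hμ]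
  have hR : ∫⁻ a, ∫⁻ b, ENNReal.ofReal (a * b / (x ^ 2 + a * b))
      ∂(recursionLaw ρ x μ) ∂(μ : Measure ℝ) = ∑' m, ρ m * I m := by
    have hm := measurable_recursion x
    have h1 : ∀ a : ℝ, ∫⁻ b, ENNReal.ofReal (a * b / (x ^ 2 + a * b)) ∂(recursionLaw ρ x μ)
        = ∑' m, ρ m * ∫⁻ X, ENNReal.ofReal (a * (x ^ 2 / (x ^ 2 + ∑ i ∈ Finset.range m, X i)) /
          (x ^ 2 + a * (x ^ 2 / (x ^ 2 + ∑ i ∈ Finset.range m, X i)))) ∂κ := by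
      intro a
      rw [recursionLaw, lintegral_map (by fun_prop) hm, lintegral_pmf_prod ρ _ (by fun_prop)]
    simp_rw [h1]
    have h2 : ∀ m : ℕ, Measurable fun p : ℝ × (ℕ → ℝ) =>
        ENNReal.ofReal (p.1 * (x ^ 2 / (x ^ 2 + ∑ i ∈ Finset.range m, p.2 i)) /
          (x ^ 2 + p.1 * (x ^ 2 / (x ^ 2 + ∑ i ∈ Finset.range m, p.2 i)))) := by
      intro m
      fun_prop
    rw [lintegral_tsum fun m => ((h2 m).lintegral_prod_right'.const_mul _).aemeasurable]
    refine tsum_congr fun m => ?_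
    rw [lintegral_const_mul _ (h2 m).lintegral_prod_right', hI]
    dsimp only
    rw [← lintegral_prod _ (h2 m).aemeasurable]
    congr 1
    -- With b = x²/(x²+S) one has ab/(x²+ab) = a/(x²+a+S).
    refine lintegral_congr_ae ?_
    have ha : ∀ᵐ p ∂((μ : Measure ℝ).prod κ), p.1 ∈ Icc (0 : ℝ) 1 :=
      Measure.quasiMeasurePreserving_fst.ae (p := fun y => y ∈ Icc (0 : ℝ) 1) hμ
    have hb : ∀ᵐ p ∂((μ : Measure ℝ).prod κ), ∀ i, p.2 i ∈ Icc (0 : ℝ) 1 :=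
      Measure.quasiMeasurePreserving_snd.ae (ae_infinitePi_mem hμ)
    filter_upwards [ha, hb] with p hp1 hp2
    have hs : 0 ≤ ∑ j ∈ Finset.range m, p.2 j := Finset.sum_nonneg fun i _ => (hp2 i).1
    have hp := hp1.1
    congr 1
    field_simp
    ring
  rw [hL, hR, ← ENNReal.tsum_mul_left]
  refine tsum_congr fun m => ?_
  -- Size biasing: (m+1) P_{m+1} equals the mean of `P` times ρ_m.
  rw [h.2 m, ← hC, ← mul_assoc, ← mul_assoc, ENNReal.mul_div_cancel (mean_ne_zero h) h.1,
    mul_comm (P (m + 1))]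

theorem measurable_edge (x : ℝ) :
    Measurable fun p : ℝ × ℝ => ENNReal.ofReal (p.1 * p.2 / (x ^ 2 + p.1 * p.2)) := by
  fun_prop

/-- Both sides integrate the symmetric kernel ab/(x²+ab) against `μ` and `ν`, in opposite orders. -/
theorem lintegral_recursionLaw_balance {P ρ : PMF ℕ} (h : IsUnimodular P ρ) {x : ℝ} (hx : 0 < x)
    {μ ν : ProbabilityMeasure ℝ} (hμ : (μ : Measure ℝ) (Icc (0 : ℝ) 1)ᶜ = 0)
    (hν : (ν : Measure ℝ) (Icc (0 : ℝ) 1)ᶜ = 0) (hμν : recursionLaw ρ x μ = (ν : Measure ℝ))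
    (hνμ : recursionLaw ρ x ν = (μ : Measure ℝ)) :
    ∫⁻ y, ENNReal.ofReal (1 - y) ∂(recursionLaw P x μ)
      = ∫⁻ y, ENNReal.ofReal (1 - y) ∂(recursionLaw P x ν) := by
  rw [lintegral_one_sub_recursionLaw h hx μ hμ, lintegral_one_sub_recursionLaw h hx ν hν, hμν, hνμ,
    lintegral_lintegral_swap (measurable_edge x).aemeasurable]
  simp_rw [mul_comm]

end Balance

/-! ### Existence and uniqueness of the fixed law -/

section FixedLaw

/-- The law of a functional of the Galton-Watson tree in which every individual has offspring
distribution `ρ`. -/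
noncomputable def gwLaw (ρ : PMF ℕ) {Y : (List ℕ → ℕ) → ℝ} (hY : Measurable Y) :
    ProbabilityMeasure ℝ :=
  ⟨(gwMeasure ρ ρ).map Y, Measure.isProbabilityMeasure_map hY.aemeasurable⟩

theorem gwLaw_compl_Icc (ρ : PMF ℕ) {Y : (List ℕ → ℕ) → ℝ} (hY : Measurable Y)
    (h : ∀ k, Y k ∈ Icc (0 : ℝ) 1) : (gwLaw ρ hY : Measure ℝ) (Icc (0 : ℝ) 1)ᶜ = 0 := by
  change ((gwMeasure ρ ρ).map Y) _ = 0
  rw [Measure.map_apply hY measurableSet_Icc.compl]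
  have : Y ⁻¹' (Icc (0 : ℝ) 1)ᶜ = ∅ := by
    ext k
    simpa using h k
  rw [this, measure_empty]

theorem recursionLaw_gwLaw (P ρ : PMF ℕ) (x : ℝ) {Y W : (List ℕ → ℕ) → ℝ} (hY : Measurable Y)
    (hW : ∀ k, W k = x ^ 2 / (x ^ 2 + ∑ i ∈ Finset.range (k []), Y (subtreeOffspring k i))) :
    recursionLaw P x (gwLaw ρ hY) = (gwMeasure P ρ).map W :=
  (map_gwMeasure_recursion P ρ x hY hW _ rfl).symm

/-- The laws of U and L under `ρ` are exchanged by the recursion, so balance gives U and L equal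
means at a root of law `P`; since L ≤ U pointwise, they agree almost surely. -/
theorem gwLower_eq_gwUpper_of_root {P ρ : PMF ℕ} (h : IsUnimodular P ρ) {x : ℝ} (hx : 0 < x) :
    gwLower x =ᵐ[gwMeasure P ρ] gwUpper x := by
  have hU := measurable_gwUpper hx
  have hL := measurable_gwLower hx
  have hbal := lintegral_recursionLaw_balance h hx
    (gwLaw_compl_Icc ρ hU (gwUpper_mem hx)) (gwLaw_compl_Icc ρ hL (gwLower_mem hx))
    (recursionLaw_gwLaw ρ ρ x hU (gwLower_recursion hx))
    (recursionLaw_gwLaw ρ ρ x hL (gwUpper_recursion hx))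
  rw [recursionLaw_gwLaw P ρ x hU (gwLower_recursion hx),
    recursionLaw_gwLaw P ρ x hL (gwUpper_recursion hx), lintegral_map (by fun_prop) hL,
    lintegral_map (by fun_prop) hU] at hbal
  have hfin : ∫⁻ k, ENNReal.ofReal (1 - gwUpper x k) ∂(gwMeasure P ρ) ≠ ∞ := by
    refine ((lintegral_mono fun k => ?_).trans_lt (b := ∫⁻ _, 1 ∂(gwMeasure P ρ)) (by simp)).ne
    rw [ENNReal.ofReal_le_one]
    have := (gwUpper_mem hx k).1
    linarith
  have hae := ae_eq_of_ae_le_of_lintegral_le (μ := gwMeasure P ρ)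
    (f := fun k => ENNReal.ofReal (1 - gwUpper x k)) (g := fun k => ENNReal.ofReal (1 - gwLower x k))
    (Eventually.of_forall fun k => ENNReal.ofReal_le_ofReal
      (sub_le_sub_left (gwLower_le_gwUpper hx k) 1)) hfin (by fun_prop) hbal.le
  filter_upwards [hae] with k hk
  have h1 := (gwUpper_mem hx k).2
  have h2 := (gwLower_mem hx k).2
  have := (ENNReal.ofReal_eq_ofReal_iff (by linarith) (by linarith)).1 hk
  linarith

theorem exists_pos_apply_ne_zero {P ρ : PMF ℕ} (h : IsUnimodular P ρ) : ∃ n, 0 < n ∧ P n ≠ 0 := by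
  by_contra! hP
  refine mean_ne_zero h (ENNReal.tsum_eq_zero.2 fun n => ?_)
  rcases Nat.eq_zero_or_pos n with rfl | hn
  · simp
  · rw [hP n hn, mul_zero]

theorem gwLower_eq_gwUpper {P ρ : PMF ℕ} (h : IsUnimodular P ρ) {x : ℝ} (hx : 0 < x) :
    gwLower x =ᵐ[gwMeasure ρ ρ] gwUpper x := by
  have hU := measurable_gwUpper hx
  have hL := measurable_gwLower hx
  have h1 : ∀ᵐ k ∂(gwMeasure P ρ), 0 < k [] →
      gwLower x (subtreeOffspring k 0) = gwUpper x (subtreeOffspring k 0) := by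
    filter_upwards [gwLower_eq_gwUpper_of_root h hx] with k hk hpos
    rw [gwLower_recursion hx, gwUpper_recursion hx] at hk
    have hs1 : 0 ≤ ∑ i ∈ Finset.range (k []), gwLower x (subtreeOffspring k i) :=
      Finset.sum_nonneg fun i _ => (gwLower_mem hx _).1
    have hs2 : 0 ≤ ∑ i ∈ Finset.range (k []), gwUpper x (subtreeOffspring k i) :=
      Finset.sum_nonneg fun i _ => (gwUpper_mem hx _).1
    have hsum : ∑ i ∈ Finset.range (k []), gwLower x (subtreeOffspring k i)
        = ∑ i ∈ Finset.range (k []), gwUpper x (subtreeOffspring k i) := by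
      have hx2 : 0 < x ^ 2 := by positivity
      rw [div_eq_div_iff (by positivity) (by positivity)] at hk
      have := mul_left_cancel₀ hx2.ne' hk
      linarith
    -- Equal sums of termwise ordered messages force termwise equality, in particular at child 0.
    exact (Finset.sum_eq_sum_iff_of_le fun i _ => gwLower_le_gwUpper hx _).1 hsum 0
      (Finset.mem_range.2 hpos)
  have hmeas : Measurable fun k : List ℕ → ℕ => (k [], subtreeOffspring k) :=
    (measurable_pi_apply []).prodMk measurable_subtreeOffspring
  have hset : MeasurableSet {p : ℕ × (ℕ → List ℕ → ℕ) |
      0 < p.1 → gwLower x (p.2 0) = gwUpper x (p.2 0)} := by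
    have hA : MeasurableSet {p : ℕ × (ℕ → List ℕ → ℕ) | gwLower x (p.2 0) = gwUpper x (p.2 0)} :=
      measurableSet_eq_fun (by fun_prop) (by fun_prop)
    have hB : MeasurableSet {p : ℕ × (ℕ → List ℕ → ℕ) | 0 < p.1} :=
      measurableSet_lt measurable_const measurable_fst
    exact hB.imp hA
  have h2 := (ae_map_iff hmeas.aemeasurable hset).2 h1
  rw [gwMeasure_map, ae_iff] at h2
  -- A positive root degree `n` has positive probability and is independent of the subtree of child
  -- 0, so a null event in the product is already null for that subtree.
  obtain ⟨n, hn, hPn⟩ := exists_pos_apply_ne_zero h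
  have h3 : (P.toMeasure.prod (Measure.infinitePi fun _ : ℕ => gwMeasure ρ ρ))
      ({n} ×ˢ {κ : ℕ → List ℕ → ℕ | ¬ gwLower x (κ 0) = gwUpper x (κ 0)}) = 0 := by
    refine measure_mono_null ?_ h2
    rintro ⟨m, κ⟩ ⟨hm, hκ⟩
    obtain rfl : m = n := hm
    exact fun himp => hκ (himp hn)
  rw [Measure.prod_prod, PMF.toMeasure_apply_singleton _ _ (measurableSet_singleton n),
    mul_eq_zero, or_iff_right hPn] at h3
  have h4 : ∀ᵐ κ ∂(Measure.infinitePi fun _ : ℕ => gwMeasure ρ ρ),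
      gwLower x (κ 0) = gwUpper x (κ 0) := h3
  rw [← Measure.infinitePi_map_eval (fun _ : ℕ => gwMeasure ρ ρ) 0]
  exact (ae_map_iff (measurable_pi_apply 0).aemeasurable (measurableSet_eq_fun hL hU)).2 h4

/-- `α` is stochastically dominated by `β`, both being supported in `[0,1]`. -/
def StochasticLE (α β : Measure ℝ) : Prop :=
  ∃ π : Measure (ℝ × ℝ), IsProbabilityMeasure π ∧ π.map Prod.fst = α ∧ π.map Prod.snd = β ∧
    ∀ᵐ p ∂π, 0 ≤ p.1 ∧ p.1 ≤ p.2 ∧ p.2 ≤ 1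

/-- Feed the same offspring number and i.i.d. coupled pairs into the recursion; monotonicity then
holds pathwise, in reverse. -/
theorem StochasticLE.recursionLaw (D : PMF ℕ) {x : ℝ} (hx : 0 < x) {α β : ProbabilityMeasure ℝ}
    (h : StochasticLE α β) :
    StochasticLE (MonomerDimer.recursionLaw D x β) (MonomerDimer.recursionLaw D x α) := by
  obtain ⟨π, hπ, h1, h2, h3⟩ := h
  have hm := measurable_recursion x
  set F : ℕ × (ℕ → ℝ) → ℝ := fun p => x ^ 2 / (x ^ 2 + ∑ i ∈ Finset.range p.1, p.2 i) with hF
  set fst' : ℕ × (ℕ → ℝ × ℝ) → ℕ × (ℕ → ℝ) := Prod.map id fun Z i => (Z i).1 with hfst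
  set snd' : ℕ × (ℕ → ℝ × ℝ) → ℕ × (ℕ → ℝ) := Prod.map id fun Z i => (Z i).2 with hsnd
  have hmf : Measurable fst' := by fun_prop
  have hms : Measurable snd' := by fun_prop
  set κ := D.toMeasure.prod (Measure.infinitePi fun _ : ℕ => π) with hκ
  have hpair : Measurable fun q => (F (snd' q), F (fst' q)) :=
    (hm.comp hms).prodMk (hm.comp hmf)
  have hf : κ.map fst' = D.toMeasure.prod (Measure.infinitePi fun _ : ℕ => (α : Measure ℝ)) := by
    rw [hκ, hfst, ← Measure.map_prod_map _ _ measurable_id (by fun_prop), Measure.map_id,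
      Measure.infinitePi_map_pi _ fun _ => measurable_fst]
    simp_rw [h1]
  have hs : κ.map snd' = D.toMeasure.prod (Measure.infinitePi fun _ : ℕ => (β : Measure ℝ)) := by
    rw [hκ, hsnd, ← Measure.map_prod_map _ _ measurable_id (by fun_prop), Measure.map_id,
      Measure.infinitePi_map_pi _ fun _ => measurable_snd]
    simp_rw [h2]
  refine ⟨κ.map fun q => (F (snd' q), F (fst' q)),
    Measure.isProbabilityMeasure_map hpair.aemeasurable, ?_, ?_, ?_⟩
  · rw [Measure.map_map measurable_fst hpair, MonomerDimer.recursionLaw, ← hs,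
      Measure.map_map hm hms]
    rfl
  · rw [Measure.map_map measurable_snd hpair, MonomerDimer.recursionLaw, ← hf,
      Measure.map_map hm hmf]
    rfl
  · rw [ae_map_iff hpair.aemeasurable]
    · have hae : ∀ᵐ q ∂κ, ∀ i, q.2 i ∈ {p : ℝ × ℝ | 0 ≤ p.1 ∧ p.1 ≤ p.2 ∧ p.2 ≤ 1} :=
        Measure.quasiMeasurePreserving_snd.ae (ae_infinitePi_mem h3)
      filter_upwards [hae] with q hq
      have hs1 : 0 ≤ ∑ i ∈ Finset.range q.1, (q.2 i).1 := Finset.sum_nonneg fun i _ => (hq i).1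
      have hs2 : ∑ i ∈ Finset.range q.1, (q.2 i).1 ≤ ∑ i ∈ Finset.range q.1, (q.2 i).2 :=
        Finset.sum_le_sum fun i _ => (hq i).2.1
      exact ⟨(sq_div_mem hx (hs1.trans hs2)).1, sq_div_antitone hx hs1 hs2, (sq_div_mem hx hs1).2⟩
    · exact (measurableSet_le measurable_const measurable_fst).inter
        ((measurableSet_le measurable_fst measurable_snd).inter
          (measurableSet_le measurable_snd measurable_const))

theorem integrable_of_ae_mem_Icc {S : Type*} [MeasurableSpace S] {π : Measure S}
    [IsFiniteMeasure π] {f : S → ℝ} (hf : Measurable f) (h : ∀ᵐ p ∂π, 0 ≤ f p ∧ f p ≤ 1) :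
    Integrable f π := by
  refine Integrable.of_bound hf.aestronglyMeasurable 1 ?_
  filter_upwards [h] with p hp
  rw [Real.norm_eq_abs, abs_of_nonneg hp.1]
  exact hp.2

theorem StochasticLE.integral_le {α β : Measure ℝ} (h : StochasticLE α β) :
    ∫ y, y ∂α ≤ ∫ y, y ∂β := by
  obtain ⟨π, hπ, rfl, rfl, h3⟩ := h
  rw [integral_map (by fun_prop) (by fun_prop), integral_map (by fun_prop) (by fun_prop)]
  refine integral_mono_ae (integrable_of_ae_mem_Icc measurable_fst ?_)
    (integrable_of_ae_mem_Icc measurable_snd ?_) ?_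
  · filter_upwards [h3] with p hp using ⟨hp.1, hp.2.1.trans hp.2.2⟩
  · filter_upwards [h3] with p hp using ⟨hp.1.trans hp.2.1, hp.2.2⟩
  · filter_upwards [h3] with p hp using hp.2.1

/-- Under a monotone coupling the mean distance of the two variables is just the difference of their
means, so convergence of means controls weak convergence. -/
theorem StochasticLE.abs_integral_sub_le {α β : Measure ℝ} (h : StochasticLE α β) {f : ℝ → ℝ}
    {K : NNReal} (hf : LipschitzWith K f) (hb : ∃ C, ∀ y, |f y| ≤ C) :
    |∫ y, f y ∂β - ∫ y, f y ∂α| ≤ K * (∫ y, y ∂β - ∫ y, y ∂α) := by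
  obtain ⟨π, hπ, rfl, rfl, h3⟩ := h
  obtain ⟨C, hC⟩ := hb
  have hfm : Measurable f := hf.continuous.measurable
  have i1 : Integrable (fun p : ℝ × ℝ => p.1) π := integrable_of_ae_mem_Icc measurable_fst (by
    filter_upwards [h3] with p hp using ⟨hp.1, hp.2.1.trans hp.2.2⟩)
  have i2 : Integrable (fun p : ℝ × ℝ => p.2) π := integrable_of_ae_mem_Icc measurable_snd (by
    filter_upwards [h3] with p hp using ⟨hp.1.trans hp.2.1, hp.2.2⟩)
  have j1 : Integrable (fun p : ℝ × ℝ => f p.1) π :=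
    Integrable.of_bound (hfm.comp measurable_fst).aestronglyMeasurable C
      (Eventually.of_forall fun p => hC _)
  have j2 : Integrable (fun p : ℝ × ℝ => f p.2) π :=
    Integrable.of_bound (hfm.comp measurable_snd).aestronglyMeasurable C
      (Eventually.of_forall fun p => hC _)
  have key : ∀ g : ℝ → ℝ, Measurable g →
      ∫ y, g y ∂(π.map Prod.fst) = ∫ p, g p.1 ∂π ∧ ∫ y, g y ∂(π.map Prod.snd) = ∫ p, g p.2 ∂π :=
    fun g hg => ⟨integral_map (by fun_prop) hg.aestronglyMeasurable,
      integral_map (by fun_prop) hg.aestronglyMeasurable⟩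
  rw [(key f hfm).1, (key f hfm).2, (key (fun y => y) measurable_id).1,
    (key (fun y => y) measurable_id).2, ← integral_sub j2 j1, ← integral_sub i2 i1,
    ← integral_const_mul]
  refine (abs_integral_le_integral_abs).trans ?_
  refine integral_mono_ae (j2.sub j1).abs ((i2.sub i1).const_mul _) ?_
  filter_upwards [h3] with p hp
  have := hf.dist_le_mul p.2 p.1
  rwa [Real.dist_eq, Real.dist_eq, abs_of_nonneg (sub_nonneg.2 hp.2.1)] at this

theorem stochasticLE_gwLaw {ρ : PMF ℕ} {x : ℝ} (hx : 0 < x) {μ : ProbabilityMeasure ℝ}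
    (hμ : IsFixedLaw ρ x μ) (n : ℕ) :
    StochasticLE μ (gwLaw ρ (measurable_gwCavity x (2 * n))) ∧
      StochasticLE (gwLaw ρ (measurable_gwCavity x (2 * n + 1))) μ := by
  have hrec : ∀ r, recursionLaw ρ x (gwLaw ρ (measurable_gwCavity x r))
      = (gwLaw ρ (measurable_gwCavity x (r + 1)) : Measure ℝ) :=
    fun r => recursionLaw_gwLaw ρ ρ x (measurable_gwCavity x r) fun k => rfl
  have step : ∀ r, StochasticLE μ (gwLaw ρ (measurable_gwCavity x r)) →
      StochasticLE (gwLaw ρ (measurable_gwCavity x (r + 1))) μ := by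
    intro r h
    have := h.recursionLaw ρ hx
    rwa [hrec, hμ.2] at this
  have step' : ∀ r, StochasticLE (gwLaw ρ (measurable_gwCavity x r)) μ →
      StochasticLE μ (gwLaw ρ (measurable_gwCavity x (r + 1))) := by
    intro r h
    have := h.recursionLaw ρ hx
    rwa [hrec, hμ.2] at this
  have main : StochasticLE μ (gwLaw ρ (measurable_gwCavity x (2 * n))) := by
    induction n with
    | zero =>
      -- The iterate of depth 0 is the constant 1, which dominates any law supported in [0,1].
      refine ⟨(μ : Measure ℝ).map fun y => (y, 1),
        Measure.isProbabilityMeasure_map (by fun_prop), ?_, ?_, ?_⟩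
      · rw [Measure.map_map measurable_fst (by fun_prop)]
        exact Measure.map_id
      · rw [Measure.map_map measurable_snd (by fun_prop)]
        change (μ : Measure ℝ).map (fun _ => 1) = (gwMeasure ρ ρ).map (fun _ => 1)
        rw [Measure.map_const, Measure.map_const, measure_univ, measure_univ]
      · rw [ae_map_iff (by fun_prop)]
        · filter_upwards [show ∀ᵐ y ∂(μ : Measure ℝ), y ∈ Icc (0 : ℝ) 1 from hμ.1] with y hy
          exact ⟨hy.1, hy.2, le_rfl⟩
        · exact (measurableSet_le measurable_const measurable_fst).inter
            ((measurableSet_le measurable_fst measurable_snd).inter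
              (measurableSet_le measurable_snd measurable_const))
    | succ n ih => exact step' _ (step _ ih)
  exact ⟨main, step _ main⟩

theorem tendsto_integral_gwCavity_even (P ρ : PMF ℕ) {x : ℝ} (hx : 0 < x) {f : ℝ → ℝ}
    (hf : Continuous f) (hb : ∃ C, ∀ y, |f y| ≤ C) :
    Tendsto (fun n => ∫ k, f (gwCavity x (2 * n) k) ∂(gwMeasure P ρ)) atTop
      (𝓝 (∫ k, f (gwUpper x k) ∂(gwMeasure P ρ))) := by
  obtain ⟨C, hC⟩ := hb
  refine tendsto_integral_of_dominated_convergence (fun _ => C) (fun n => ?_)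
    (integrable_const C) (fun n => Eventually.of_forall fun k => hC _)
    (Eventually.of_forall fun k => (hf.tendsto _).comp (tendsto_gwUpper hx k))
  exact (hf.measurable.comp (measurable_gwCavity x (2 * n))).aestronglyMeasurable

theorem tendsto_integral_gwUpper (P ρ : PMF ℕ) {x : ℝ} (hx : 0 < x) :
    Tendsto (fun n => ∫ k, gwCavity x (2 * n) k ∂(gwMeasure P ρ)) atTop
      (𝓝 (∫ k, gwUpper x k ∂(gwMeasure P ρ))) := by
  refine tendsto_integral_of_dominated_convergence (fun _ => 1)
    (fun n => (measurable_gwCavity x (2 * n)).aestronglyMeasurable)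
    (integrable_const 1) (fun n => Eventually.of_forall fun k => ?_)
    (Eventually.of_forall fun k => tendsto_gwUpper hx k)
  have := gwCavity_mem hx (2 * n) k
  rw [Real.norm_eq_abs, abs_of_nonneg this.1]
  exact this.2

theorem tendsto_integral_gwLower (P ρ : PMF ℕ) {x : ℝ} (hx : 0 < x) :
    Tendsto (fun n => ∫ k, gwCavity x (2 * n + 1) k ∂(gwMeasure P ρ)) atTop
      (𝓝 (∫ k, gwLower x k ∂(gwMeasure P ρ))) := by
  refine tendsto_integral_of_dominated_convergence (fun _ => 1)
    (fun n => (measurable_gwCavity x (2 * n + 1)).aestronglyMeasurable)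
    (integrable_const 1) (fun n => Eventually.of_forall fun k => ?_)
    (Eventually.of_forall fun k => tendsto_gwLower hx k)
  have := gwCavity_mem hx (2 * n + 1) k
  rw [Real.norm_eq_abs, abs_of_nonneg this.1]
  exact this.2

theorem isFixedLaw_gwLaw {P ρ : PMF ℕ} (h : IsUnimodular P ρ) {x : ℝ} (hx : 0 < x) :
    IsFixedLaw ρ x (gwLaw ρ (measurable_gwUpper hx)) := by
  refine ⟨gwLaw_compl_Icc ρ _ (gwUpper_mem hx), ?_⟩
  rw [recursionLaw_gwLaw ρ ρ x (measurable_gwUpper hx) (gwLower_recursion hx)]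
  exact Measure.map_congr (gwLower_eq_gwUpper h hx)

theorem integral_gwLaw (ρ : PMF ℕ) {Y : (List ℕ → ℕ) → ℝ} (hY : Measurable Y) {f : ℝ → ℝ}
    (hf : Measurable f) :
    ∫ y, f y ∂(gwLaw ρ hY : Measure ℝ) = ∫ k, f (Y k) ∂(gwMeasure ρ ρ) :=
  integral_map hY.aemeasurable hf.aestronglyMeasurable

/-- `μ` lies between the odd and even iterates, whose means have a common limit. Integrals of
bounded Lipschitz functions against `μ` therefore agree with those against the limit law. -/
theorem IsFixedLaw.eq_gwLaw {P ρ : PMF ℕ} (h : IsUnimodular P ρ) {x : ℝ} (hx : 0 < x)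
    {μ : ProbabilityMeasure ℝ} (hμ : IsFixedLaw ρ x μ) : μ = gwLaw ρ (measurable_gwUpper hx) := by
  suffices Tendsto (fun _ : ℕ => μ) atTop (𝓝 (gwLaw ρ (measurable_gwUpper hx))) from
    tendsto_nhds_unique tendsto_const_nhds this
  rw [tendsto_iff_forall_lipschitz_integral_tendsto]
  rintro f ⟨C, hC⟩ ⟨K, hK⟩
  have hfb : ∃ C, ∀ y, |f y| ≤ C := by
    refine ⟨C + |f 0|, fun y => ?_⟩
    have h1 := hC y 0
    rw [Real.dist_eq] at h1
    have h2 := abs_sub_abs_le_abs_sub (f y) (f 0)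
    linarith
  have hgap : Tendsto (fun n => (K : ℝ) * (∫ k, gwCavity x (2 * n) k ∂(gwMeasure ρ ρ)
      - ∫ k, gwCavity x (2 * n + 1) k ∂(gwMeasure ρ ρ))) atTop (𝓝 0) := by
    have := ((tendsto_integral_gwUpper ρ ρ hx).sub (tendsto_integral_gwLower ρ ρ hx)).const_mul
      (K : ℝ)
    rwa [integral_congr_ae (gwLower_eq_gwUpper h hx), sub_self, mul_zero] at this
  have hlim := tendsto_integral_gwCavity_even ρ ρ hx hK.continuous hfb
  have hzero : Tendsto (fun n => ∫ k, f (gwCavity x (2 * n) k) ∂(gwMeasure ρ ρ)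
      - ∫ y, f y ∂(μ : Measure ℝ)) atTop (𝓝 0) := by
    refine squeeze_zero_norm (fun n => ?_) hgap
    obtain ⟨h1, h2⟩ := stochasticLE_gwLaw hx hμ n
    have h3 := h1.abs_integral_sub_le hK hfb
    have h4 := h2.integral_le
    have e := fun r => integral_gwLaw ρ (measurable_gwCavity x r) measurable_id
    simp only [id] at e
    rw [integral_gwLaw ρ _ hK.continuous.measurable, e] at h3
    rw [e] at h4
    refine h3.trans (mul_le_mul_of_nonneg_left ?_ K.2)
    linarith
  have := tendsto_nhds_unique hzero (hlim.sub_const _)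
  rw [integral_gwLaw ρ _ hK.continuous.measurable, ← sub_eq_zero.1 this.symm]
  exact tendsto_const_nhds

theorem integral_recursionLaw_gwLaw {P ρ : PMF ℕ} (h : IsUnimodular P ρ) {x : ℝ} (hx : 0 < x) :
    ∫ y, y ∂(recursionLaw P x (gwLaw ρ (measurable_gwUpper hx)))
      = ∫ k, gwUpper x k ∂(gwMeasure P ρ) := by
  rw [recursionLaw_gwLaw P ρ x (measurable_gwUpper hx) (gwLower_recursion hx),
    integral_map (measurable_gwLower hx).aemeasurable (by fun_prop),
    integral_congr_ae (gwLower_eq_gwUpper_of_root h hx)]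

theorem integrable_recursionLaw_gwLaw (P ρ : PMF ℕ) {x : ℝ} (hx : 0 < x) :
    Integrable (fun y => y) (recursionLaw P x (gwLaw ρ (measurable_gwUpper hx))) := by
  rw [recursionLaw_gwLaw P ρ x (measurable_gwUpper hx) (gwLower_recursion hx),
    integrable_map_measure (by fun_prop) (measurable_gwLower hx).aemeasurable]
  exact integrable_of_ae_mem_Icc (measurable_gwLower hx)
    (Eventually.of_forall fun k => gwLower_mem hx k)

end FixedLaw

/-! ### Rooted isomorphisms -/

section Isomorphism

universe u₁ u₂ u₃

variable {V : Type u₁} {W : Type u₂} {U : Type u₃} {G : SimpleGraph V} {v : V} {H : SimpleGraph W}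
  {w : W} {L : SimpleGraph U} {u : U}

theorem RootedIso.refl (G : SimpleGraph V) (v : V) : RootedIso G v G v :=
  ⟨SimpleGraph.Iso.refl, rfl⟩

theorem RootedIso.symm (h : RootedIso G v H w) : RootedIso H w G v := by
  obtain ⟨φ, rfl⟩ := h
  exact ⟨φ.symm, φ.symm_apply_apply v⟩

theorem RootedIso.trans (h : RootedIso G v H w) (h' : RootedIso H w L u) : RootedIso G v L u := by
  obtain ⟨φ, rfl⟩ := h
  obtain ⟨ψ, rfl⟩ := h'
  exact ⟨ψ.comp φ, rfl⟩

theorem RootedIso.congr_right (h : RootedIso H w L u) :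
    RootedIso G v H w ↔ RootedIso G v L u :=
  ⟨fun h' => h'.trans h, fun h' => h'.trans h.symm⟩

theorem exists_rootedIso_fin [Fintype V] (G : SimpleGraph V) (v : V) :
    ∃ (m : ℕ) (T : SimpleGraph (Fin m)) (o : Fin m), RootedIso G v T o :=
  ⟨Fintype.card V, G.map (Fintype.equivFin V).toEmbedding, Fintype.equivFin V v,
    SimpleGraph.Iso.map (Fintype.equivFin V) G, rfl⟩

theorem edist_iso_le {V : Type u₁} {W : Type u₂} {G : SimpleGraph V}
    {H : SimpleGraph W} (φ : G ≃g H) (a b : V) : H.edist (φ a) (φ b) ≤ G.edist a b := by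
  rw [SimpleGraph.edist]
  refine le_iInf fun p => ?_
  have := (p.map φ.toHom).edist_le
  rwa [SimpleGraph.Walk.length_map] at this

end Isomorphism

/-! ### From local convergence to convergence of monomer densities -/

section TreeClasses

/-- Two families of offspring numbers are equivalent if their trees have isomorphic truncations. -/
def gwSetoid (r : ℕ) : Setoid (List ℕ → ℕ) where
  r k k' := RootedIso (gwTree k r) (gwRoot k r) (gwTree k' r) (gwRoot k' r)
  iseqv := ⟨fun _ => RootedIso.refl _ _, fun h => h.symm, fun h h' => h.trans h'⟩

theorem rootedIso_of_gwNodesUpTo_eq {k k' : List ℕ → ℕ} {r : ℕ}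
    (h : gwNodesUpTo k r = gwNodesUpTo k' r) :
    RootedIso (gwTree k r) (gwRoot k r) (gwTree k' r) (gwRoot k' r) := by
  refine ⟨⟨Equiv.setCongr h, ?_⟩, rfl⟩
  intro a b
  rfl

/-- A truncated tree is determined by its finite set of words, and there are countably many of
these. -/
instance countable_quotient_gwSetoid (r : ℕ) : Countable (Quotient (gwSetoid r)) := by
  refine Function.Injective.countable
    (f := fun q : Quotient (gwSetoid r) => (finite_gwNodesUpTo r q.out).toFinset) fun q q' h => ?_
  rw [← Quotient.out_equiv_out]
  exact rootedIso_of_gwNodesUpTo_eq (Set.Finite.toFinset_inj.1 h)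

theorem measurableSet_mem_gwNodesUpTo (r : ℕ) (u : List ℕ) :
    MeasurableSet {k : List ℕ → ℕ | u ∈ gwNodesUpTo k r} := by
  have : {k : List ℕ → ℕ | u ∈ gwNodesUpTo k r}
      = {_k | u.length ≤ r} ∩ ⋂ (w : List ℕ) (i : ℕ) (_ : w ++ [i] <+: u), {k | i < k w} := by
    ext k
    simp [gwNodesUpTo, gwNodes, and_comm]
  rw [this]
  refine (MeasurableSet.const _).inter (.iInter fun w => .iInter fun i => .iInter fun _ => ?_)
  exact measurableSet_lt measurable_const (measurable_pi_apply w)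

theorem measurableSet_gwNodesUpTo_eq (r : ℕ) (S : Set (List ℕ)) :
    MeasurableSet {k : List ℕ → ℕ | gwNodesUpTo k r = S} := by
  have : {k : List ℕ → ℕ | gwNodesUpTo k r = S} = ⋂ u, {k | u ∈ gwNodesUpTo k r ↔ u ∈ S} := by
    ext k
    simp [Set.ext_iff]
  rw [this]
  refine .iInter fun u => ?_
  by_cases hu : u ∈ S
  · simpa [hu] using measurableSet_mem_gwNodesUpTo r u
  · simp only [hu, iff_false]
    exact (measurableSet_mem_gwNodesUpTo r u).compl

theorem measurableSet_rootedIso (r : ℕ) (k₀ : List ℕ → ℕ) :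
    MeasurableSet {k : List ℕ → ℕ |
      RootedIso (gwTree k r) (gwRoot k r) (gwTree k₀ r) (gwRoot k₀ r)} := by
  have : {k : List ℕ → ℕ | RootedIso (gwTree k r) (gwRoot k r) (gwTree k₀ r) (gwRoot k₀ r)}
      = ⋃ S ∈ {S : Finset (List ℕ) | ∃ k, gwNodesUpTo k r = S ∧
          RootedIso (gwTree k r) (gwRoot k r) (gwTree k₀ r) (gwRoot k₀ r)},
        {k | gwNodesUpTo k r = S} := by
    ext k
    simp only [Set.mem_ofPred_eq, mem_iUnion, exists_prop]
    constructor
    · intro h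
      exact ⟨(finite_gwNodesUpTo r k).toFinset, ⟨k, by simp, h⟩, by simp⟩
    · rintro ⟨S, ⟨k', hk', h⟩, hk⟩
      exact (rootedIso_of_gwNodesUpTo_eq (hk.trans hk'.symm)).trans h
  rw [this]
  exact .biUnion (to_countable _) fun S _ => measurableSet_gwNodesUpTo_eq r S

/-- The event that the truncated Galton-Watson tree belongs to a given isomorphism class. -/
def gwEvent (r : ℕ) (q : Quotient (gwSetoid r)) : Set (List ℕ → ℕ) :=
  {k | RootedIso (gwTree k r) (gwRoot k r) (gwTree q.out r) (gwRoot q.out r)}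

theorem mem_gwEvent {r : ℕ} {q : Quotient (gwSetoid r)} {k : List ℕ → ℕ} :
    k ∈ gwEvent r q ↔ (Quotient.mk (gwSetoid r) k) = q := by
  conv_rhs => rw [← Quotient.out_eq q]
  exact (Quotient.eq (r := gwSetoid r)).symm

/-- Tightness: finitely many classes carry all but ε of the mass. -/
theorem hasSum_gwEvent (P ρ : PMF ℕ) (r : ℕ) :
    HasSum (fun q => (gwMeasure P ρ).real (gwEvent r q)) 1 := by
  have h1 : ∑' q, gwMeasure P ρ (gwEvent r q) = 1 := by
    rw [← measure_iUnion, ← measure_univ (μ := gwMeasure P ρ)]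
    · congr 1
      ext k
      simp [mem_gwEvent]
    · intro q q' hne
      rw [Function.onFun, Set.disjoint_left]
      intro k hk hk'
      exact hne ((mem_gwEvent.1 hk).symm.trans (mem_gwEvent.1 hk'))
    · exact fun q => measurableSet_rootedIso r _
  have h2 := ENNReal.hasSum_toReal (f := fun q => gwMeasure P ρ (gwEvent r q)) (by rw [h1]; simp)
  rw [← ENNReal.tsum_toReal_eq fun q => measure_ne_top _ _, h1, ENNReal.toReal_one] at h2
  exact h2

/-- On all but the classes outside of `B`, a function with values in `[0,1]` is determined by the
class. -/
theorem sum_indicator_bounds {Q : Type*} (B : Finset Q) (p : Q → Prop) [DecidablePred p]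
    (hp : ∀ q q', p q → p q' → q = q') (F : Q → ℝ) {c : ℝ} (hc : c ∈ Icc (0 : ℝ) 1)
    (hF : ∀ q, p q → c = F q) :
    ∑ q ∈ B, (if p q then 1 else 0) * F q ≤ c ∧
      c ≤ ∑ q ∈ B, (if p q then 1 else 0) * F q + (1 - ∑ q ∈ B, if p q then 1 else 0) := by
  by_cases h : ∃ q ∈ B, p q
  · obtain ⟨q, hq, hpq⟩ := h
    have h0 : ∀ q' ∈ B, q' ≠ q → ¬ p q' := fun q' _ hne hpq' => hne (hp _ _ hpq' hpq)
    rw [Finset.sum_eq_single_of_mem q hq fun q' h1 h2 => by rw [if_neg (h0 q' h1 h2), zero_mul],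
      Finset.sum_eq_single_of_mem q hq fun q' h1 h2 => by rw [if_neg (h0 q' h1 h2)]]
    simp [hpq, hF q hpq]
  · push Not at h
    rw [Finset.sum_eq_zero fun q hq => by rw [if_neg (h q hq), zero_mul],
      Finset.sum_eq_zero fun q hq => by rw [if_neg (h q hq)]]
    simpa using hc

theorem integral_gwCavity_bounds (P ρ : PMF ℕ) {x : ℝ} (hx : 0 < x) (r : ℕ)
    (B : Finset (Quotient (gwSetoid r))) :
    ∑ q ∈ B, (gwMeasure P ρ).real (gwEvent r q) * gwCavity x r q.out
        ≤ ∫ k, gwCavity x r k ∂(gwMeasure P ρ) ∧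
      ∫ k, gwCavity x r k ∂(gwMeasure P ρ)
        ≤ ∑ q ∈ B, (gwMeasure P ρ).real (gwEvent r q) * gwCavity x r q.out
          + (1 - ∑ q ∈ B, (gwMeasure P ρ).real (gwEvent r q)) := by
  classical
  have key := fun k => sum_indicator_bounds B (fun q => k ∈ gwEvent r q)
    (fun q q' h h' => (mem_gwEvent.1 h).symm.trans (mem_gwEvent.1 h'))
    (fun q => gwCavity x r q.out) (gwCavity_mem hx r k) (fun q h => by
      rw [← cavity_gwTree, ← cavity_gwTree]
      exact RootedIso.cavity_eq h x r)
  have hind : ∀ q : Quotient (gwSetoid r),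
      Integrable (fun k => if k ∈ gwEvent r q then (1 : ℝ) else 0) (gwMeasure P ρ) ∧
      ∫ k, (if k ∈ gwEvent r q then (1 : ℝ) else 0) ∂(gwMeasure P ρ)
        = (gwMeasure P ρ).real (gwEvent r q) := by
    intro q
    have hm : MeasurableSet (gwEvent r q) := measurableSet_rootedIso r _
    have : (fun k => if k ∈ gwEvent r q then (1 : ℝ) else 0) = (gwEvent r q).indicator 1 := by
      ext k
      simp [Set.indicator_apply]
    rw [this]
    exact ⟨(integrable_const (1 : ℝ)).indicator hm, integral_indicator_one hm⟩
  have hS : Integrable (fun k => ∑ q ∈ B, (if k ∈ gwEvent r q then (1 : ℝ) else 0)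
      * gwCavity x r q.out) (gwMeasure P ρ) :=
    integrable_finsetSum _ fun q _ => (hind q).1.mul_const _
  have hs : Integrable (fun k => ∑ q ∈ B, (if k ∈ gwEvent r q then (1 : ℝ) else 0))
      (gwMeasure P ρ) :=
    integrable_finsetSum _ fun q _ => (hind q).1
  have hSv : ∫ k, ∑ q ∈ B, (if k ∈ gwEvent r q then (1 : ℝ) else 0) * gwCavity x r q.out
      ∂(gwMeasure P ρ) = ∑ q ∈ B, (gwMeasure P ρ).real (gwEvent r q) * gwCavity x r q.out := by
    rw [integral_finsetSum _ fun q _ => (hind q).1.mul_const _]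
    exact Finset.sum_congr rfl fun q _ => by rw [integral_mul_const, (hind q).2]
  have hsv : ∫ k, ∑ q ∈ B, (if k ∈ gwEvent r q then (1 : ℝ) else 0) ∂(gwMeasure P ρ)
      = ∑ q ∈ B, (gwMeasure P ρ).real (gwEvent r q) := by
    rw [integral_finsetSum _ fun q _ => (hind q).1]
    exact Finset.sum_congr rfl fun q _ => (hind q).2
  have hc : Integrable (gwCavity x r) (gwMeasure P ρ) :=
    integrable_of_ae_mem_Icc (measurable_gwCavity x r)
      (Eventually.of_forall fun k => gwCavity_mem hx r k)
  constructor
  · rw [← hSv]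
    exact integral_mono hS hc fun k => (key k).1
  · have hsub : Integrable (fun k => 1 - ∑ q ∈ B, (if k ∈ gwEvent r q then (1 : ℝ) else 0))
        (gwMeasure P ρ) := (integrable_const (1 : ℝ)).sub hs
    have h1 := integral_mono hc (hS.add hsub) fun k => (key k).2
    simp only [Pi.add_apply] at h1
    rw [integral_add hS hsub, integral_sub (integrable_const (1 : ℝ)) hs, hSv, hsv] at h1
    simpa using h1

theorem average_cavity_bounds {V : Type*} [Fintype V] (G : SimpleGraph V) {x : ℝ} (hx : 0 < x)
    (r : ℕ) (B : Finset (Quotient (gwSetoid r))) :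
    ∑ q ∈ B, ballFrequency G r (gwTree q.out r) (gwRoot q.out r) * gwCavity x r q.out
        ≤ (∑ v, cavity x r G v) / Fintype.card V ∧
      (∑ v, cavity x r G v) / Fintype.card V
        ≤ ∑ q ∈ B, ballFrequency G r (gwTree q.out r) (gwRoot q.out r) * gwCavity x r q.out
          + (1 - ∑ q ∈ B, ballFrequency G r (gwTree q.out r) (gwRoot q.out r)) := by
  classical
  have key := fun v => sum_indicator_bounds B
    (fun q => BallIso G v r (gwTree q.out r) (gwRoot q.out r))
    (fun q q' h h' => by
      rw [← Quotient.out_equiv_out]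
      exact RootedIso.trans (RootedIso.symm h) h')
    (fun q => gwCavity x r q.out) (cavity_mem hx r G v) (fun q h => by
      rw [← cavity_gwTree]
      exact BallIso.cavity_eq h x)
  -- For an empty vertex set all averages are 0 by the convention for division by zero, and the
  -- bounds still hold.
  rcases Nat.eq_zero_or_pos (Fintype.card V) with h0 | hpos
  · simp [ballFrequency, h0]
  · have hpos' : (0 : ℝ) < Fintype.card V := by exact_mod_cast hpos
    have hS : ∑ q ∈ B, ballFrequency G r (gwTree q.out r) (gwRoot q.out r) * gwCavity x r q.out
        = (∑ v, ∑ q ∈ B, (if BallIso G v r (gwTree q.out r) (gwRoot q.out r) then (1 : ℝ) else 0)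
          * gwCavity x r q.out) / Fintype.card V := by
      rw [Finset.sum_comm, Finset.sum_div]
      refine Finset.sum_congr rfl fun q _ => ?_
      rw [ballFrequency, ← Finset.sum_mul]
      ring
    have hs : ∑ q ∈ B, ballFrequency G r (gwTree q.out r) (gwRoot q.out r)
        = (∑ v, ∑ q ∈ B, (if BallIso G v r (gwTree q.out r) (gwRoot q.out r) then (1 : ℝ) else 0))
          / Fintype.card V := by
      rw [Finset.sum_comm, Finset.sum_div]
      exact Finset.sum_congr rfl fun q _ => rfl
    rw [hS, hs]
    constructor
    · gcongr with v
      exact (key v).1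
    · have h1 := Finset.sum_le_sum fun v (_ : v ∈ Finset.univ) => (key v).2
      rw [Finset.sum_add_distrib, Finset.sum_sub_distrib] at h1
      simp only [Finset.sum_const, Finset.card_univ, nsmul_eq_mul, mul_one] at h1
      rw [div_le_iff₀ hpos']
      refine h1.trans (le_of_eq ?_)
      field_simp

/-- Local convergence along one realisation gives the convergence of the averages of the cavity
recursion of a fixed depth. -/
theorem tendsto_average_cavity (P ρ : PMF ℕ) {V : ℕ → Type*} [∀ n, Fintype (V n)]
    (G : ∀ n, SimpleGraph (V n)) {r : ℕ}
    (h : ∀ q : Quotient (gwSetoid r),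
      Tendsto (fun n => ballFrequency (G n) r (gwTree q.out r) (gwRoot q.out r)) atTop
        (𝓝 ((gwMeasure P ρ).real (gwEvent r q)))) {x : ℝ} (hx : 0 < x) :
    Tendsto (fun n => (∑ v, cavity x r (G n) v) / Fintype.card (V n)) atTop
      (𝓝 (∫ k, gwCavity x r k ∂(gwMeasure P ρ))) := by
  set E := ∫ k, gwCavity x r k ∂(gwMeasure P ρ) with hE
  -- The frequencies of the classes in `B` converge, so all remaining balls, including those that
  -- are not trees, have limiting frequency below ε.
  have hB : ∀ ε > 0, ∃ B : Finset (Quotient (gwSetoid r)),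
      1 - ε < ∑ q ∈ B, (gwMeasure P ρ).real (gwEvent r q) := by
    intro ε hε
    exact ((hasSum_gwEvent P ρ r).eventually (lt_mem_nhds (by linarith))).exists
  have hSlim := fun B : Finset (Quotient (gwSetoid r)) => tendsto_finsetSum B fun q _ =>
    (h q).mul_const (gwCavity x r q.out)
  have hslim := fun B : Finset (Quotient (gwSetoid r)) => tendsto_finsetSum B fun q _ => h q
  rw [tendsto_order]
  constructor
  · intro a ha
    obtain ⟨B, hB⟩ := hB (E - a) (by linarith)
    obtain ⟨-, h2⟩ := integral_gwCavity_bounds P ρ hx r B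
    filter_upwards [(hSlim B).eventually (lt_mem_nhds (show a < _ by linarith))] with n hn
    exact hn.trans_le (average_cavity_bounds (G n) hx r B).1
  · intro a ha
    obtain ⟨B, hB⟩ := hB (a - E) (by linarith)
    obtain ⟨h1, -⟩ := integral_gwCavity_bounds P ρ hx r B
    filter_upwards [((hSlim B).add ((hslim B).const_sub 1)).eventually_lt_const
      (show _ < a by linarith)] with n hn
    exact (average_cavity_bounds (G n) hx r B).2.trans_lt hn

/-- There are only countably many pairs of a radius and a class, so one null set serves them all. It
does not involve x, which later gives convergence for all x simultaneously. -/
theorem LocallyConverges.ae_tendsto {Ω : Type*} [MeasurableSpace Ω] {ℙ : Measure Ω}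
    {V : ℕ → Ω → Type*} [∀ n ω, Fintype (V n ω)] {G : ∀ n ω, SimpleGraph (V n ω)} {P ρ : PMF ℕ}
    (h : LocallyConverges ℙ G P ρ) :
    ∀ᵐ ω ∂ℙ, ∀ (r : ℕ) (q : Quotient (gwSetoid r)),
      Tendsto (fun n => ballFrequency (G n ω) r (gwTree q.out r) (gwRoot q.out r)) atTop
        (𝓝 ((gwMeasure P ρ).real (gwEvent r q))) := by
  rw [ae_all_iff]
  intro r
  rw [ae_all_iff]
  intro q
  classical
  obtain ⟨m, T, o, hT⟩ := exists_rootedIso_fin (gwTree q.out r) (gwRoot q.out r)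
  have h1 : T.IsTree := by
    obtain ⟨φ, -⟩ := hT
    exact φ.isTree_iff.1 (isTree_gwTree _ _)
  have h2 : ∀ v, T.edist o v ≤ r := by
    obtain ⟨φ, rfl⟩ := hT
    intro v
    obtain ⟨u, rfl⟩ := φ.surjective v
    exact (edist_iso_le φ _ _).trans (edist_gwRoot_le _ _ u)
  filter_upwards [h r m T o h1 h2] with ω hω
  have h3 : gwProb P ρ r T o = (gwMeasure P ρ).real (gwEvent r q) := by
    rw [gwProb, gwEvent]
    congr 1
    ext k
    exact hT.congr_right.symm
  have h4 : ∀ n, ballFrequency (G n ω) r T o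
      = ballFrequency (G n ω) r (gwTree q.out r) (gwRoot q.out r) := by
    intro n
    unfold ballFrequency
    congr 1
    refine Finset.sum_congr rfl fun v _ => ?_
    have : BallIso (G n ω) v r T o ↔ BallIso (G n ω) v r (gwTree q.out r) (gwRoot q.out r) :=
      hT.congr_right.symm
    exact if_congr this rfl rfl
  rw [← h3]
  simpa only [h4] using hω

/-- Local convergence along one realisation gives the convergence of the monomer densities. -/
theorem tendsto_average_monomerProb {P ρ : PMF ℕ} (hP : IsUnimodular P ρ) {V : ℕ → Type*}
    [∀ n, Fintype (V n)] (G : ∀ n, SimpleGraph (V n))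
    (h : ∀ (r : ℕ) (q : Quotient (gwSetoid r)),
      Tendsto (fun n => ballFrequency (G n) r (gwTree q.out r) (gwRoot q.out r)) atTop
        (𝓝 ((gwMeasure P ρ).real (gwEvent r q)))) {x : ℝ} (hx : 0 < x) :
    Tendsto (fun n => (∑ v, monomerProb (G n) x v) / Fintype.card (V n)) atTop
      (𝓝 (∫ k, gwUpper x k ∂(gwMeasure P ρ))) := by
  -- The depth is chosen first, from the tree limits; `n` tends to infinity at that fixed depth.
  have hL := tendsto_integral_gwLower P ρ hx
  rw [integral_congr_ae (gwLower_eq_gwUpper_of_root hP hx)] at hL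
  have hU := tendsto_integral_gwUpper P ρ hx
  rw [tendsto_order]
  constructor
  · intro a ha
    obtain ⟨m, hm⟩ := (hL.eventually (lt_mem_nhds ha)).exists
    filter_upwards [(tendsto_average_cavity P ρ G (h (2 * m + 1)) hx).eventually (lt_mem_nhds hm)]
      with n hn
    refine hn.trans_le ?_
    gcongr with v
    exact (cavity_bounds_monomerProb hx m (G n) v).2
  · intro a ha
    obtain ⟨m, hm⟩ := (hU.eventually (gt_mem_nhds ha)).exists
    filter_upwards [(tendsto_average_cavity P ρ G (h (2 * m)) hx).eventually (gt_mem_nhds hm)]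
      with n hn
    refine lt_of_le_of_lt ?_ hn
    gcongr with v
    exact (cavity_bounds_monomerProb hx m (G n) v).1

end TreeClasses

/-! ### Analyticity of the limit -/

section Analytic

theorem exists_tendsto_ultrafilter (U : Ultrafilter ℕ) {u : ℕ → ℝ} {C : ℝ} (h : ∀ n, |u n| ≤ C) :
    ∃ b, |b| ≤ C ∧ Tendsto u U (𝓝 b) := by
  obtain ⟨b, hb, hU⟩ := (isCompact_Icc (a := -C) (b := C)).ultrafilter_le_nhds (U.map u) (by
    rw [le_principal_iff]
    exact Filter.mem_map.2 (Filter.univ_mem' fun n => abs_le.1 (h n)))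
  exact ⟨b, abs_le.2 hb, hU⟩

theorem norm_taylorCoeff_le {f : ℂ → ℂ} {c : ℂ} {R M : ℝ} (hR : 0 < R)
    (hd : DifferentiableOn ℂ f (Metric.ball c R)) (hM : ∀ z ∈ Metric.ball c R, ‖f z‖ ≤ M) (k : ℕ) :
    ‖(k.factorial : ℂ)⁻¹ * iteratedDeriv k f c‖ ≤ M / (R / 2) ^ k := by
  have hsub : Metric.closedBall c (R / 2) ⊆ Metric.ball c R :=
    Metric.closedBall_subset_ball (by linarith)
  have h1 := Complex.norm_iteratedDeriv_le_of_forall_mem_sphere_norm_le k (half_pos hR)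
    ((hd.mono hsub).diffContOnCl_ball subset_rfl)
    fun z hz => hM z (hsub (Metric.sphere_subset_closedBall hz))
  have hk : (0 : ℝ) < k.factorial := by exact_mod_cast k.factorial_pos
  rw [norm_mul, norm_inv, Complex.norm_natCast]
  calc (k.factorial : ℝ)⁻¹ * ‖iteratedDeriv k f c‖
      ≤ (k.factorial : ℝ)⁻¹ * (k.factorial * M / (R / 2) ^ k) := by gcongr
    _ = M / (R / 2) ^ k := by field_simp

/-- A pointwise limit, on an interval, of the real parts of a bounded sequence of holomorphic
functions is analytic. -/
theorem analyticAt_of_tendsto_re {f : ℕ → ℂ → ℂ} {F : ℝ → ℝ} {x₀ R M : ℝ} (hR : 0 < R)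
    (hd : ∀ n, DifferentiableOn ℂ (f n) (Metric.ball (x₀ : ℂ) R))
    (hM : ∀ n, ∀ z ∈ Metric.ball (x₀ : ℂ) R, ‖f n z‖ ≤ M)
    (hF : ∀ x ∈ Metric.ball x₀ R, Tendsto (fun n => (f n (x : ℂ)).re) atTop (𝓝 (F x))) :
    AnalyticAt ℝ F x₀ := by
  set a : ℕ → ℕ → ℝ := fun n k => ((k.factorial : ℂ)⁻¹ * iteratedDeriv k (f n) x₀).re with ha
  have hab : ∀ n k, |a n k| ≤ M / (R / 2) ^ k := fun n k =>
    (Complex.abs_re_le_norm _).trans (norm_taylorCoeff_le hR (hd n) (hM n) k)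
  -- A limit along an ultrafilter finer than `atTop` exists for all the bounded coefficient
  -- sequences at once and replaces a diagonal subsequence.
  set U : Ultrafilter ℕ := Ultrafilter.of atTop
  choose b hb hlim using fun k => exists_tendsto_ultrafilter U fun n => hab n k
  have hsum : ∀ n, ∀ y : ℝ, |y| < R →
      HasSum (fun k => y ^ k * a n k) (f n ((x₀ + y : ℝ) : ℂ)).re := by
    intro n y hy
    have hmem : ((x₀ + y : ℝ) : ℂ) ∈ Metric.ball (x₀ : ℂ) R := by
      rw [mem_ball_iff_norm, Complex.ofReal_add, add_sub_cancel_left, Complex.norm_real]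
      exact hy
    have h1 := Complex.hasSum_re (Complex.hasSum_taylorSeries_on_ball (hd n) hmem)
    convert! h1 using 2 with k
    rw [ha, Complex.ofReal_add, add_sub_cancel_left, ← Complex.ofReal_pow, smul_eq_mul,
      smul_eq_mul, mul_left_comm, Complex.re_ofReal_mul]
  have hM0 : 0 ≤ M := (norm_nonneg _).trans (hM 0 x₀ (Metric.mem_ball_self hR))
  -- Cauchy's estimate at radius R/2 and |y| < R/4 give the ratio 1/2, a domination uniform in `n`.
  have hterm : ∀ y : ℝ, |y| < R / 4 → ∀ (u : ℝ) (k : ℕ), |u| ≤ M / (R / 2) ^ k →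
      ‖y ^ k * u‖ ≤ M * (1 / 2) ^ k := by
    intro y hy u k hu
    rw [Real.norm_eq_abs, abs_mul, abs_pow]
    calc |y| ^ k * |u| ≤ (R / 4) ^ k * (M / (R / 2) ^ k) := by gcongr
      _ = M * ((R / 4) / (R / 2)) ^ k := by rw [div_pow (R / 4) (R / 2)]; ring
      _ = M * (1 / 2) ^ k := by
        congr 2
        field_simp
        norm_num
  have hgeom : Summable fun k : ℕ => M * (1 / 2 : ℝ) ^ k := summable_geometric_two.mul_left M
  refine ⟨FormalMultilinearSeries.ofScalars ℝ b, hasFPowerSeriesAt_iff.2 ?_⟩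
  filter_upwards [Metric.ball_mem_nhds (0 : ℝ) (show 0 < R / 4 by linarith)] with y hy
  have hy' : |y| < R / 4 := by simpa using hy
  simp only [FormalMultilinearSeries.coeff_ofScalars, smul_eq_mul]
  have hs : Summable fun k => y ^ k * b k :=
    Summable.of_norm_bounded hgeom fun k => hterm y hy' (b k) k (hb k)
  have h1 := tendsto_tsum_of_dominated_convergence (𝓕 := (U : Filter ℕ))
    (f := fun n k => y ^ k * a n k) hgeom (fun k => (hlim k).const_mul (y ^ k))
    (Eventually.of_forall fun n k => hterm y hy' (a n k) k (hab n k))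
  have h2 : Tendsto (fun n => ∑' k, y ^ k * a n k) U (𝓝 (F (x₀ + y))) := by
    have h3 := (hF (x₀ + y) (by
      rw [Metric.mem_ball, Real.dist_eq, add_sub_cancel_left]
      linarith)).mono_left (Ultrafilter.of_le atTop)
    refine h3.congr fun n => ?_
    exact (hsum n y (by linarith)).tsum_eq.symm
  rw [tendsto_nhds_unique h2 h1]
  exact hs.hasSum

/-- The average of the complex cavity recursion, divided by the activity. -/
noncomputable def averageCavity {V : Type*} [Fintype V] (G : SimpleGraph V) (z : ℂ) : ℂ :=
  (∑ v, cavity z G.edgeSet.ncard G v / z) / Fintype.card V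

theorem norm_averageCavity_le {V : Type*} [Fintype V] (G : SimpleGraph V) {z : ℂ} (hz : 0 < z.re) :
    ‖averageCavity G z‖ ≤ 1 / z.re := by
  rw [averageCavity, norm_div, Complex.norm_natCast]
  refine div_le_of_le_mul₀ (Nat.cast_nonneg _) (by positivity) ?_
  refine (norm_sum_le_of_le _ fun v _ => (cavity_div_bounds hz _ G v).2).trans (le_of_eq ?_)
  simp [mul_comm]

theorem differentiableOn_averageCavity {V : Type*} [Fintype V] (G : SimpleGraph V) :
    DifferentiableOn ℂ (averageCavity G) {z | 0 < z.re} := by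
  unfold averageCavity
  refine DifferentiableOn.div_const (DifferentiableOn.fun_sum fun v _ => ?_) _
  refine (differentiableOn_cavity _ G v).div differentiableOn_id ?_
  rintro z hz rfl
  simp at hz

theorem averageCavity_ofReal {V : Type*} [Fintype V] (G : SimpleGraph V) {x : ℝ} (hx : 0 < x) :
    (averageCavity G x).re = (∑ v, monomerProb G x v) / Fintype.card V / x := by
  have h : averageCavity G x = (((∑ v, monomerProb G x v) / Fintype.card V / x : ℝ) : ℂ) := by
    rw [averageCavity]
    simp_rw [cavity_ofReal, cavity_eq_monomerProb hx _ G _ le_rfl]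
    push_cast
    rw [← Finset.sum_div, div_right_comm]
  rw [h, Complex.ofReal_re]

theorem analyticAt_of_tendsto_average {V : ℕ → Type*} [∀ n, Fintype (V n)]
    (G : ∀ n, SimpleGraph (V n)) {F : ℝ → ℝ}
    (hF : ∀ x, 0 < x →
      Tendsto (fun n => (∑ v, monomerProb (G n) x v) / Fintype.card (V n)) atTop (𝓝 (F x)))
    {x₀ : ℝ} (hx₀ : 0 < x₀) : AnalyticAt ℝ F x₀ := by
  have hball : ∀ z ∈ Metric.ball (x₀ : ℂ) (x₀ / 2), x₀ / 2 < z.re := by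
    intro z hz
    rw [mem_ball_iff_norm'] at hz
    have h1 := (Complex.re_le_norm ((x₀ : ℂ) - z)).trans_lt hz
    rw [Complex.sub_re, Complex.ofReal_re] at h1
    linarith
  -- The uniform bound is available for R/z, so the quotient by x is treated first; on the ball of
  -- radius x₀/2 the real part exceeds x₀/2.
  have h1 : AnalyticAt ℝ (fun x => F x / x) x₀ := by
    refine analyticAt_of_tendsto_re (f := fun n => averageCavity (G n)) (half_pos hx₀)
      (M := 1 / (x₀ / 2)) (fun n => ?_) (fun n z hz => ?_) fun x hx => ?_
    · exact (differentiableOn_averageCavity (G n)).mono fun z hz =>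
        (half_pos hx₀).trans (hball z hz)
    · have h2 := hball z hz
      exact (norm_averageCavity_le (G n) ((half_pos hx₀).trans h2)).trans
        (one_div_le_one_div_of_le (half_pos hx₀) h2.le)
    · have hx' : 0 < x := by
        rw [Metric.mem_ball, Real.dist_eq] at hx
        have := (abs_lt.1 hx).1
        linarith
      simp_rw [averageCavity_ofReal _ hx']
      exact (hF x hx').div_const x
  refine (h1.mul analyticAt_id).congr ?_
  filter_upwards [lt_mem_nhds hx₀] with x hx
  simp only [Pi.mul_apply, id]
  field_simp

end Analytic

end MonomerDimer

theorem mainTheorem1 {Ω : Type*} [MeasurableSpace Ω] (ℙ : Measure Ω) [IsProbabilityMeasure ℙ]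
    (V : ℕ → Ω → Type*) [∀ n ω, Fintype (V n ω)] (G : ∀ n ω, SimpleGraph (V n ω))
    (P ρ : PMF ℕ) (hunimodular : IsUnimodular P ρ)
    (hlocal : LocallyConverges ℙ G P ρ)
    (hmoment : ∑' k : ℕ, (k : ℝ≥0∞) ^ 2 * P k ≠ ∞) :
    (∀ n ω, ∀ x : ℝ, 0 < x →
      DifferentiableAt ℝ (pressurePerParticle (G n ω)) x ∧
      monomerDensity (G n ω) x =
        (∑ v, monomerProb (G n ω) x v) / Fintype.card (V n ω)) ∧
    ∃ X : ℝ → ProbabilityMeasure ℝ,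
      (∀ x : ℝ, 0 < x → IsFixedLaw ρ x (X x) ∧ ∀ μ, IsFixedLaw ρ x μ → μ = X x) ∧
      (∀ x : ℝ, 0 < x → Integrable (fun y => y) (recursionLaw P x (X x))) ∧
      (∀ᵐ ω ∂ℙ, ∀ x : ℝ, 0 < x →
        Tendsto (fun n => monomerDensity (G n ω) x) atTop
          (𝓝 (∫ y, y ∂(recursionLaw P x (X x))))) ∧
      AnalyticOnNhd ℝ (fun x => ∫ y, y ∂(recursionLaw P x (X x))) (Ioi 0) := by
  refine ⟨fun n ω x hx => ⟨(hasDerivAt_pressurePerParticle (G n ω) hx).differentiableAt,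
    monomerDensity_eq (G n ω) hx⟩, ?_⟩
  let X : ℝ → ProbabilityMeasure ℝ := fun x =>
    if hx : 0 < x then gwLaw ρ (measurable_gwUpper hx) else ⟨Measure.dirac 0, inferInstance⟩
  have hX : ∀ x (hx : 0 < x), X x = gwLaw ρ (measurable_gwUpper hx) := fun x hx => dif_pos hx
  have hint : ∀ x : ℝ, 0 < x →
      ∫ y, y ∂(recursionLaw P x (X x)) = ∫ k, gwUpper x k ∂(gwMeasure P ρ) := by
    intro x hx
    rw [hX x hx]
    exact integral_recursionLaw_gwLaw hunimodular hx
  have hlim : ∀ᵐ ω ∂ℙ, ∀ x : ℝ, 0 < x →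
      Tendsto (fun n => (∑ v, monomerProb (G n ω) x v) / Fintype.card (V n ω)) atTop
        (𝓝 (∫ y, y ∂(recursionLaw P x (X x)))) := by
    filter_upwards [hlocal.ae_tendsto] with ω hω x hx
    rw [hint x hx]
    exact tendsto_average_monomerProb hunimodular (fun n => G n ω) hω hx
  refine ⟨X, fun x hx => ?_, fun x hx => ?_, ?_, ?_⟩
  · rw [hX x hx]
    exact ⟨isFixedLaw_gwLaw hunimodular hx, fun μ hμ => hμ.eq_gwLaw hunimodular hx⟩
  · rw [hX x hx]
    exact integrable_recursionLaw_gwLaw P ρ hx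
  · filter_upwards [hlim] with ω hω x hx
    simp_rw [monomerDensity_eq _ hx]
    exact hω x hx
  -- The limit is deterministic, so a single good realisation suffices.
  · obtain ⟨ω, hω⟩ := hlim.exists
    intro x hx
    exact analyticAt_of_tendsto_average (fun n => G n ω) hω hx
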